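/- Let \[ H_{0,1}(x)=\frac{e^{\sqrt2 x}}{(1+e^{2\sqrt2 x})^{1/2}},\qquad H_{-1,0}(x)=-\frac{e^{-\sqrt2 x}}{(1+e^{-2\sqrt2 x})^{1/2}},\qquad x\in\mathbb{R}, \] and for $u\in L^\infty(\mathbb{R})$ (real-valued) let $\mathscr{F}(u):=u''-2u+8u^3-6u^5$, where $u''$ is taken in the sense of distributions and $\|\mathscr{F}(u)\|_{L^2}:=+\infty$ if $\mathscr{F}(u)\notin L^2(\mathbb{R})$. There exist constants $a>0$, $\varepsilon>0$ and $C>0$ with the following property. Let $u\in L^\infty(\mathbb{R})$ and suppose that there are $x_1,x_2\in\mathbb{R}$ with $x_2-x_1>a$ and \[ \|u-H_{0,1}(\cdot+x_1)-H_{-1,0}(\cdot+x_2)\|_{H^1(\mathbb{R})}<\varepsilon . \] Then there exist $y_1,y_2\in\mathbb{R}$ such that \[ \|u-H_{0,1}(\cdot+y_1)-H_{-1,0}(\cdot+y_2)\|_{H^1(\mathbb{R})}+e^{-\sqrt2\,(y_2-y_1)}\le C\,\|\mathscr{F}(u)\|_{L^2(\mathbb{R})}. \] -/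

import Mathlib

open MeasureTheory
open scoped ENNReal ContDiff

noncomputable section

/-- The kink `H_{0,1}(x) = e^{√2 x} / (1 + e^{2√2 x})^{1/2}`, connecting `0` to `1`. -/
def kinkZeroOne (x : ℝ) : ℝ :=
  Real.exp (√2 * x) / √(1 + Real.exp (2 * √2 * x))

/-- The kink `H_{-1,0}(x) = -e^{-√2 x} / (1 + e^{-2√2 x})^{1/2}`, connecting `-1` to `0`. -/
def kinkNegOneZero (x : ℝ) : ℝ :=
  -Real.exp (-(√2 * x)) / √(1 + Real.exp (-(2 * √2 * x)))

/-- `g` is the weak (distributional) `k`-th derivative of `f` on the real line: both are locally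
integrable and `∫ f φ⁽ᵏ⁾ = (-1)ᵏ ∫ g φ` for every smooth compactly supported `φ`. -/
def HasWeakDeriv (k : ℕ) (f g : ℝ → ℝ) : Prop :=
  LocallyIntegrable f volume ∧ LocallyIntegrable g volume ∧
    ∀ φ : ℝ → ℝ, ContDiff ℝ ∞ φ → HasCompactSupport φ →
      ∫ x, f x * iteratedDeriv k φ x = (-1) ^ k * ∫ x, g x * φ x

/-- The extended `H¹(ℝ)` norm `(‖f‖²_{L²} + ‖f'‖²_{L²})^{1/2}`, with `f'` the weak derivative
(unique up to null sets). It is `∞` when `f` has no locally integrable weak derivative (infimum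
over the empty set), and so it is finite exactly when `f` belongs to `H¹(ℝ)`. -/
def hOneNorm (f : ℝ → ℝ) : ℝ≥0∞ :=
  ⨅ (g : ℝ → ℝ) (_ : HasWeakDeriv 1 f g),
    (eLpNorm f 2 volume ^ 2 + eLpNorm g 2 volume ^ 2) ^ (1 / 2 : ℝ)

/-- The extended `L²(ℝ)` norm of `u'' - 2u + 8u³ - 6u⁵`, with `u''` the weak second derivative
(unique up to null sets). For bounded `u` it is finite exactly when the distribution
`u'' - 2u + 8u³ - 6u⁵` is (represented by) a function in `L²(ℝ)`, and `∞` otherwise. -/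
def stationaryDefectNorm (u : ℝ → ℝ) : ℝ≥0∞ :=
  ⨅ (w : ℝ → ℝ) (_ : HasWeakDeriv 2 u w),
    eLpNorm (fun x => w x - 2 * u x + 8 * u x ^ 3 - 6 * u x ^ 5) 2 volume

end

/-! Write `w u = √2 * u * (1 - u ^ 2)`. Then `w * w' = 2 * u - 8 * u ^ 3 + 6 * u ^ 5`, and
`kinkZeroOne` solves the first-order equation `h' = w h`. For `U'' = w U * w' U + f`, where `f` is
the stationary defect, the Bogomolny defect `p = U' - w U` satisfies the linear equation `p' + w' U
* p = f`. Almost everything is read off from this equation.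

Closeness to the kink sum gives points `s ≤ b` with `U s = -1/5` and `U b = 1/5`. The shifts are
chosen so that the translated kinks take exactly these values there, and the line is cut at `s` and
`b`.

Right of `b` (`half_line_estimate`), a weighted energy identity bounds `p` by `f`, because `w' h ^ 2
- (w' h)' = 2 + 6 * h ^ 4` is positive along the kink. The difference `U - h` vanishes at `b` and
solves a first-order equation with source `p`, so `p` controls it. The region left of `s` is the
same after replacing `U x` by `-U (-x)`.

The separation is measured by transporting `p` (`exp_neg_length_le`). It is small at `b`, but at `s`
the profile belongs to the other kink and `p` is at least about `1/2`. Since `p` decays at rate at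
most `√2`, up to the source `f`, the interval is long: `e^{-√2 (b - s)}` is `O(‖f‖)`.

On `[s, b]` (`middle_estimate`), `U` is near `0`, where the nonlinearity is strongly monotone. The
energy estimate for the difference from the kink sum has errors from `f`, from the kink interaction
and from the end points, the last two controlled by `e^{-√2 (b - s)}`. Adding the three regions
(`kink_sum_stability`) gives the theorem. -/

noncomputable section

open Set Filter Topology

/-! ### Calculus of locally absolutely continuous functions on the line. -/

/-- `F` is locally absolutely continuous on the line with almost everywhere derivative `f`. -/
structure IsACPrimitive (F f : ℝ → ℝ) : Prop where
  ac : ∀ a b, AbsolutelyContinuousOnInterval F a b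
  ae_hasDerivAt : ∀ᵐ x, HasDerivAt F (f x) x

namespace IsACPrimitive

variable {F G f g : ℝ → ℝ}

theorem deriv_ae_eq (h : IsACPrimitive F f) : deriv F =ᵐ[volume] f := by
  filter_upwards [h.ae_hasDerivAt] with x hx using hx.deriv

theorem intervalIntegrable (h : IsACPrimitive F f) (a b : ℝ) : IntervalIntegrable f volume a b :=
  (h.ac a b).intervalIntegrable_deriv.congr_ae (ae_restrict_of_ae h.deriv_ae_eq)

theorem integral_eq_sub (h : IsACPrimitive F f) (a b : ℝ) : ∫ x in a..b, f x = F b - F a := by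
  rw [← (h.ac a b).integral_deriv_eq_sub]
  apply intervalIntegral.integral_congr_ae
  filter_upwards [h.deriv_ae_eq] with x hx _ using hx.symm

theorem continuous (h : IsACPrimitive F f) : Continuous F := by
  rw [continuous_iff_continuousAt]
  intro x
  have := (h.ac (x - 1) (x + 1)).continuousOn
  rw [uIcc_of_le (by linarith)] at this
  exact this.continuousAt (Icc_mem_nhds (by linarith) (by linarith))

theorem locallyIntegrable (h : IsACPrimitive F f) : LocallyIntegrable f volume := by
  intro x
  refine ⟨Ioc (x - 1) (x + 1), Ioc_mem_nhds (by linarith) (by linarith), ?_⟩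
  exact (intervalIntegrable_iff_integrableOn_Ioc_of_le (by linarith)).1
    (h.intervalIntegrable (x - 1) (x + 1))

theorem of_integral (hf : LocallyIntegrable f volume) (c : ℝ) :
    IsACPrimitive (fun x => c + ∫ t in (0 : ℝ)..x, f t) f where
  ac a b := by
    have hi : ∀ a b, IntervalIntegrable f volume a b := fun a b => intervalIntegrable_iff.mpr <|
      (hf.integrableOn_isCompact isCompact_uIcc).mono_set uIoc_subset_uIcc
    have h1 := (hi a b).absolutelyContinuousOnInterval_intervalIntegral (c := a) left_mem_uIcc
    have h2 : AbsolutelyContinuousOnInterval (fun _ : ℝ => c + ∫ t in (0 : ℝ)..a, f t) a b :=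
      (LipschitzWith.const _).lipschitzOnWith.absolutelyContinuousOnInterval
    have h3 : (fun x => c + ∫ t in (0 : ℝ)..x, f t)
        = (fun _ => c + ∫ t in (0 : ℝ)..a, f t) + fun x => ∫ t in a..x, f t := by
      funext x
      simp only [Pi.add_apply]
      rw [add_assoc, intervalIntegral.integral_add_adjacent_intervals (hi _ _) (hi _ _)]
    rw [h3]
    exact h2.add h1
  ae_hasDerivAt := by
    filter_upwards [LocallyIntegrable.ae_hasDerivAt_integral hf] with x hx
    exact (hx 0).const_add c

theorem of_sub_eq (hf : LocallyIntegrable f volume)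
    (h : ∀ x, ∫ t in (0 : ℝ)..x, f t = F x - F 0) : IsACPrimitive F f := by
  convert of_integral hf (F 0) using 1
  funext x
  rw [h]; ring

theorem of_hasDerivAt (h : ∀ x, HasDerivAt F (f x) x) (hf : Continuous f) : IsACPrimitive F f :=
  of_sub_eq hf.locallyIntegrable fun _ =>
    intervalIntegral.integral_eq_sub_of_hasDerivAt (fun t _ => h t) (hf.intervalIntegrable _ _)

theorem congr (h : IsACPrimitive F f) (hfg : ∀ x, f x = g x) : IsACPrimitive F g := by
  rwa [← funext hfg]

theorem add (hF : IsACPrimitive F f) (hG : IsACPrimitive G g) :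
    IsACPrimitive (fun x => F x + G x) (fun x => f x + g x) where
  ac a b := (hF.ac a b).add (hG.ac a b)
  ae_hasDerivAt := by
    filter_upwards [hF.ae_hasDerivAt, hG.ae_hasDerivAt] with x h1 h2 using h1.add h2

theorem sub (hF : IsACPrimitive F f) (hG : IsACPrimitive G g) :
    IsACPrimitive (fun x => F x - G x) (fun x => f x - g x) where
  ac a b := (hF.ac a b).sub (hG.ac a b)
  ae_hasDerivAt := by
    filter_upwards [hF.ae_hasDerivAt, hG.ae_hasDerivAt] with x h1 h2 using h1.sub h2

theorem mul (hF : IsACPrimitive F f) (hG : IsACPrimitive G g) :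
    IsACPrimitive (fun x => F x * G x) (fun x => f x * G x + F x * g x) where
  ac a b := (hF.ac a b).fun_mul (hG.ac a b)
  ae_hasDerivAt := by
    filter_upwards [hF.ae_hasDerivAt, hG.ae_hasDerivAt] with x h1 h2 using h1.mul h2

theorem const (c : ℝ) : IsACPrimitive (fun _ => c) (fun _ => 0) :=
  of_hasDerivAt (fun x => hasDerivAt_const x c) continuous_const

theorem const_mul (c : ℝ) (hF : IsACPrimitive F f) :
    IsACPrimitive (fun x => c * F x) (fun x => c * f x) :=
  ((const c).mul hF).congr fun x => by ring

theorem sq (hF : IsACPrimitive F f) :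
    IsACPrimitive (fun x => F x ^ 2) (fun x => 2 * F x * f x) := by
  simpa only [pow_two] using (hF.mul hF).congr (g := fun x => 2 * F x * f x) fun x => by ring

theorem comp_neg (hF : IsACPrimitive F f) :
    IsACPrimitive (fun x => F (-x)) (fun x => -f (-x)) := by
  refine of_sub_eq ?_ fun x => ?_
  · intro x
    have h := (hF.intervalIntegrable (-(x - 1)) (-(x + 1))).comp_sub_left 0
    refine ⟨Ioc (x - 1) (x + 1), Ioc_mem_nhds (by linarith) (by linarith), ?_⟩
    have h' := (intervalIntegrable_iff_integrableOn_Ioc_of_le (by linarith)).1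
      (by simpa using h : IntervalIntegrable (fun t => f (-t)) volume (x - 1) (x + 1))
    exact h'.neg
  · rw [intervalIntegral.integral_neg, intervalIntegral.integral_comp_neg,
      hF.integral_eq_sub]
    ring

/-- Integrability of the derivative gives a limit at infinity, and integrability of the function
forces that limit to be zero. -/
theorem tendsto_zero_atTop (hF : IsACPrimitive F f) {b : ℝ} (hFi : IntegrableOn F (Ioi b))
    (hfi : IntegrableOn f (Ioi b)) : Tendsto F atTop (𝓝 0) := by
  have h1 := intervalIntegral_tendsto_integral_Ioi b hfi tendsto_id
  have h2 : Tendsto F atTop (𝓝 (F b + ∫ x in Ioi b, f x)) := by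
    convert h1.const_add (F b) using 1
    funext x
    rw [hF.integral_eq_sub, id]; ring
  have h3 := IntegrableAtFilter.eq_zero_of_tendsto ⟨Ioi b, Ioi_mem_atTop b, hFi⟩ (by
    intro s hs
    obtain ⟨a, ha⟩ := mem_atTop_sets.1 hs
    rw [← top_le_iff, ← Real.volume_Ici (a := a)]
    exact measure_mono ha) h2
  rwa [h3] at h2

theorem integral_Ioi (hF : IsACPrimitive F f) {b : ℝ} (hFi : IntegrableOn F (Ioi b))
    (hfi : IntegrableOn f (Ioi b)) : ∫ x in Ioi b, f x = -F b := by
  have h1 := intervalIntegral_tendsto_integral_Ioi b hfi tendsto_id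
  have h2 : Tendsto (fun x => ∫ t in b..id x, f t) atTop (𝓝 (0 - F b)) := by
    simpa only [hF.integral_eq_sub, id] using
      (hF.tendsto_zero_atTop hFi hfi).sub_const (F b)
  rw [tendsto_nhds_unique h1 h2]; ring

end IsACPrimitive

/-! ### Weak derivatives and absolutely continuous representatives. -/

theorem exists_support_subset_Ioc {φ : ℝ → ℝ} (hφ : HasCompactSupport φ) :
    ∃ R : ℝ, 0 < R ∧ tsupport φ ⊆ Ioc (-R) R := by
  obtain ⟨r, hr⟩ := hφ.isCompact.isBounded.subset_closedBall 0
  refine ⟨|r| + 1, by positivity, fun x hx => ?_⟩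
  have h1 := hr hx
  rw [mem_closedBall_zero_iff, Real.norm_eq_abs] at h1
  have h2 := le_abs_self r
  have h3 := abs_le.1 (h1.trans h2)
  exact ⟨by linarith [h3.1], by linarith [h3.2]⟩

theorem integrable_mul_test {f φ : ℝ → ℝ} (hf : LocallyIntegrable f volume)
    (hφ : Continuous φ) (hc : HasCompactSupport φ) : Integrable (fun x => f x * φ x) := by
  simpa only [smul_eq_mul, mul_comm] using hf.integrable_smul_left_of_hasCompactSupport hφ hc

theorem IsACPrimitive.integral_mul_deriv_test {F f φ : ℝ → ℝ} (hF : IsACPrimitive F f)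
    (hφ : ContDiff ℝ ∞ φ) (hc : HasCompactSupport φ) :
    ∫ x, F x * deriv φ x = -∫ x, f x * φ x := by
  have hd : Continuous (deriv φ) := hφ.continuous_deriv (by simp)
  have hP : IsACPrimitive φ (deriv φ) :=
    .of_hasDerivAt (fun x => (hφ.differentiable (by simp) x).hasDerivAt) hd
  have i1 := integrable_mul_test hF.locallyIntegrable hφ.continuous hc
  have i2 := integrable_mul_test hF.continuous.locallyIntegrable hd hc.deriv
  obtain ⟨R, hR, hs⟩ := exists_support_subset_Ioc hc
  have h1 := (hF.mul hP).integral_eq_sub (-(R + 1)) (R + 1)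
  have e0 : ∀ x, x ∉ Ioc (-R) R → φ x = 0 ∧ deriv φ x = 0 := fun x hx =>
    ⟨image_eq_zero_of_notMem_tsupport fun h => hx (hs h),
      image_eq_zero_of_notMem_tsupport fun h => hx (hs (tsupport_deriv_subset h))⟩
  rw [(e0 (R + 1) fun h => by linarith [h.2]).1, (e0 (-(R + 1)) fun h => by linarith [h.1]).1,
    intervalIntegral.integral_eq_integral_of_support_subset, integral_add i1 i2] at h1
  · linarith
  · intro x hx
    by_contra h
    have := e0 x fun h' => h ⟨by linarith [h'.1], by linarith [h'.2]⟩
    exact hx (by simp [this.1, this.2])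

theorem IsACPrimitive.hasWeakDeriv {F f u : ℝ → ℝ} (hF : IsACPrimitive F f)
    (hu : u =ᵐ[volume] F) : HasWeakDeriv 1 u f := by
  refine ⟨hF.continuous.locallyIntegrable.congr hu.symm, hF.locallyIntegrable,
    fun φ hφ hc => ?_⟩
  rw [iteratedDeriv_one, pow_one, neg_one_mul, ← hF.integral_mul_deriv_test hφ hc]
  apply integral_congr_ae
  filter_upwards [hu] with x hx
  rw [hx]

theorem HasWeakDeriv.ae_eq {k : ℕ} {f g h : ℝ → ℝ} (hg : HasWeakDeriv k f g)
    (hh : HasWeakDeriv k f h) : g =ᵐ[volume] h := by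
  refine ae_eq_of_integral_contDiff_smul_eq hg.2.1 hh.2.1 fun φ hφ hc => ?_
  have h1 := (hg.2.2 φ hφ hc).symm.trans (hh.2.2 φ hφ hc)
  simpa [smul_eq_mul, mul_comm] using h1

theorem HasWeakDeriv.add {f g f' g' : ℝ → ℝ} (hf : HasWeakDeriv 1 f f')
    (hg : HasWeakDeriv 1 g g') :
    HasWeakDeriv 1 (fun x => f x + g x) (fun x => f' x + g' x) := by
  refine ⟨hf.1.add hg.1, hf.2.1.add hg.2.1, fun φ hφ hc => ?_⟩
  have e1 := hf.2.2 φ hφ hc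
  have e2 := hg.2.2 φ hφ hc
  rw [iteratedDeriv_one] at e1 e2 ⊢
  have hd : Continuous (deriv φ) := hφ.continuous_deriv (by simp)
  simp only [add_mul]
  rw [integral_add (integrable_mul_test hf.1 hd hc.deriv) (integrable_mul_test hg.1 hd hc.deriv),
    integral_add (integrable_mul_test hf.2.1 hφ.continuous hc)
      (integrable_mul_test hg.2.1 hφ.continuous hc), e1, e2]
  ring

/-- The du Bois-Reymond argument: fix a bump `ψ` of integral one. For any test function `φ`, the
function `φ - (∫ φ) ψ` has zero integral, so its primitive is again a test function. Testing against
that primitive identifies the constant as `∫ f ψ`. -/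
theorem HasWeakDeriv.ae_eq_const {f : ℝ → ℝ} (hf : HasWeakDeriv 1 f fun _ => 0) :
    ∃ c : ℝ, f =ᵐ[volume] fun _ => c := by
  let η : ContDiffBump (0 : ℝ) := ⟨1, 2, one_pos, one_lt_two⟩
  set ψ : ℝ → ℝ := η.normed volume with hψ
  have hψs : ContDiff ℝ ∞ ψ := η.contDiff_normed
  have hψc : HasCompactSupport ψ := η.hasCompactSupport_normed
  have hψi : ∫ x, ψ x = 1 := η.integral_normed
  refine ⟨∫ x, f x * ψ x, ae_eq_of_integral_contDiff_smul_eq hf.1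
    (locallyIntegrable_const _) fun φ hφ hc => ?_⟩
  set m := ∫ x, φ x with hm
  have hχ : ContDiff ℝ ∞ fun x => φ x - m * ψ x := hφ.sub (contDiff_const.mul hψs)
  have hχi : Integrable fun x => φ x - m * ψ x :=
    (hφ.continuous.integrable_of_hasCompactSupport hc).sub
      ((hψs.continuous.integrable_of_hasCompactSupport hψc).const_mul m)
  obtain ⟨R₁, hR₁, hs₁⟩ := exists_support_subset_Ioc hc
  obtain ⟨R₂, hR₂, hs₂⟩ := exists_support_subset_Ioc hψc
  set R := max R₁ R₂
  have e0 : ∀ x, x ∉ Ioc (-R) R → φ x - m * ψ x = 0 := fun x hx => by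
    have z₁ : φ x = 0 := image_eq_zero_of_notMem_tsupport fun h =>
      hx ⟨(neg_le_neg (le_max_left _ _)).trans_lt (hs₁ h).1, (hs₁ h).2.trans (le_max_left _ _)⟩
    have z₂ : ψ x = 0 := image_eq_zero_of_notMem_tsupport fun h =>
      hx ⟨(neg_le_neg (le_max_right _ _)).trans_lt (hs₂ h).1, (hs₂ h).2.trans (le_max_right _ _)⟩
    rw [z₁, z₂, mul_zero, sub_zero]
  set Φ : ℝ → ℝ := fun x => ∫ t in (-R)..x, φ t - m * ψ t with hΦ
  have hΦd : ∀ x, HasDerivAt Φ (φ x - m * ψ x) x := fun x =>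
    intervalIntegral.integral_hasDerivAt_right (hχ.continuous.intervalIntegrable _ _)
      hχ.continuous.stronglyMeasurable.stronglyMeasurableAtFilter hχ.continuous.continuousAt
  have hder : deriv Φ = fun x => φ x - m * ψ x := funext fun x => (hΦd x).deriv
  have hΦs : ContDiff ℝ ∞ Φ := by
    rw [contDiff_infty_iff_deriv, hder]
    exact ⟨fun x => (hΦd x).differentiableAt, hχ⟩
  have htot : ∫ x, (φ x - m * ψ x) = 0 := by
    rw [integral_sub (hφ.continuous.integrable_of_hasCompactSupport hc)
      ((hψs.continuous.integrable_of_hasCompactSupport hψc).const_mul m),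
      integral_const_mul, hψi, ← hm]
    ring
  have hΦc : HasCompactSupport Φ := by
    refine HasCompactSupport.intro (K := Icc (-R) R) isCompact_Icc fun x hx => ?_
    rcases lt_or_ge x (-R) with h | h
    · rw [hΦ]
      beta_reduce
      rw [intervalIntegral.integral_symm, intervalIntegral.integral_of_le h.le, neg_eq_zero]
      exact setIntegral_eq_zero_of_forall_eq_zero fun t ht =>
        e0 t fun h' => by linarith [h'.1, ht.2]
    · have hx' : R < x := not_le.1 fun h' => hx ⟨h, h'⟩
      rw [hΦ]
      beta_reduce
      rw [intervalIntegral.integral_eq_integral_of_support_subset, htot]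
      intro t ht
      by_contra h'
      exact ht (e0 t fun h'' => h' ⟨h''.1, h''.2.trans hx'.le⟩)
  have h1 := hf.2.2 Φ hΦs hΦc
  simp only [iteratedDeriv_one, hder, zero_mul, integral_zero, mul_zero, mul_sub]
    at h1
  have i1 := integrable_mul_test hf.1 hφ.continuous hc
  have i2 := integrable_mul_test hf.1 hψs.continuous hψc
  have e2 : ∀ x, f x * (m * ψ x) = m * (f x * ψ x) := fun x => by ring
  simp only [e2] at h1
  rw [integral_sub i1 (i2.const_mul m), integral_const_mul] at h1
  simp only [smul_eq_mul, integral_mul_const]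
  rw [← hm, show (fun x => φ x * f x) = fun x => f x * φ x by funext x; ring]
  linarith

theorem HasWeakDeriv.exists_isACPrimitive {f g : ℝ → ℝ} (h : HasWeakDeriv 1 f g) :
    ∃ F, f =ᵐ[volume] F ∧ IsACPrimitive F g := by
  have h1 := IsACPrimitive.of_integral h.2.1 0
  have h2 : HasWeakDeriv 1 (fun x => f x - (0 + ∫ t in (0 : ℝ)..x, g t))
      fun _ => 0 := by
    have h3 : IsACPrimitive (fun x => -(0 + ∫ t in (0 : ℝ)..x, g t)) (fun x => -g x) := by
      simpa using h1.const_mul (-1)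
    have h4 := h.add (h3.hasWeakDeriv EventuallyEq.rfl)
    simpa only [← sub_eq_add_neg, sub_self] using h4
  obtain ⟨c, hc⟩ := h2.ae_eq_const
  refine ⟨_, ?_, IsACPrimitive.of_integral h.2.1 c⟩
  filter_upwards [hc] with x hx
  linarith

/-- The second weak derivative alone says nothing about a first one. Once a first one is known,
testing it against `deriv φ` links the two. -/
theorem HasWeakDeriv.deriv_of_two {u v w : ℝ → ℝ} (h1 : HasWeakDeriv 1 u v)
    (h2 : HasWeakDeriv 2 u w) : HasWeakDeriv 1 v w := by
  refine ⟨h1.2.1, h2.2.1, fun φ hφ hc => ?_⟩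
  have hd : ContDiff ℝ ∞ (deriv φ) := (contDiff_infty_iff_deriv.1 hφ).2
  have e1 := h1.2.2 (deriv φ) hd hc.deriv
  have e2 := h2.2.2 φ hφ hc
  rw [iteratedDeriv_succ, iteratedDeriv_one] at e2
  rw [iteratedDeriv_one] at e1 ⊢
  rw [e2] at e1
  simp only [pow_one, neg_one_mul, even_two, Even.neg_pow, one_pow, one_mul] at e1 ⊢
  linarith

/-! ### The half-line carrying a single kink. -/

theorem memLp_continuous_mul_restrict {k f : ℝ → ℝ} {s : Set ℝ} {C : ℝ} (hs : MeasurableSet s)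
    (hk : Continuous k) (hC : ∀ x ∈ s, |k x| ≤ C) (hf : MemLp f 2 (volume.restrict s)) :
    MemLp (fun x => k x * f x) 2 (volume.restrict s) := by
  refine hf.of_le_mul (c := C) (hk.aestronglyMeasurable.mul hf.1) ?_
  filter_upwards [ae_restrict_mem hs] with x hx
  rw [norm_mul]
  exact mul_le_mul_of_nonneg_right (hC x hx) (norm_nonneg _)

theorem integrableOn_continuous_mul_of_bound {k f : ℝ → ℝ} {s : Set ℝ} {C : ℝ}
    (hs : MeasurableSet s) (hk : Continuous k) (hC : ∀ x ∈ s, |k x| ≤ C) (hf : IntegrableOn f s) :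
    IntegrableOn (fun x => k x * f x) s := by
  refine Integrable.bdd_mul hf hk.aestronglyMeasurable (c := C) ?_
  filter_upwards [ae_restrict_mem hs] with x hx using hC x hx

theorem two_mul_mul_le_add_sq_div (a b : ℝ) : 2 * a * b ≤ 9 / 100 * b ^ 2 + 100 / 9 * a ^ 2 := by
  nlinarith [sq_nonneg (3 / 10 * b - 10 / 3 * a)]

theorem abs_sqrt_two_mul_le {x : ℝ} (hx : |x| ≤ 4) : |√2 * x| ≤ 6 := by
  have c3 : √2 ≤ 3 / 2 := by
    rw [Real.sqrt_le_left (by norm_num)]; norm_num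
  rw [abs_mul, abs_of_nonneg (Real.sqrt_nonneg 2)]
  nlinarith [abs_nonneg x, Real.sqrt_nonneg 2]

theorem sq_sub_sq_sq_le {u h : ℝ} (h1 : |u - h| ≤ 1 / 40) (hu0 : 0 ≤ u) (hu : u ≤ 41 / 40)
    (hh0 : 0 ≤ h) (hh : h ≤ 1) : (u ^ 2 - h ^ 2) ^ 2 ≤ 1 / 384 := by
  have h3 : (u - h) ^ 2 ≤ 1 / 1600 := by
    rw [← sq_abs]; nlinarith [abs_nonneg (u - h)]
  have h5 : (u + h) ^ 2 ≤ (81 / 40) ^ 2 := pow_le_pow_left₀ (by linarith) (by linarith) 2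
  calc (u ^ 2 - h ^ 2) ^ 2 = (u - h) ^ 2 * (u + h) ^ 2 := by ring
    _ ≤ 1 / 1600 * (81 / 40) ^ 2 := mul_le_mul h3 h5 (sq_nonneg _) (by norm_num)
    _ ≤ _ := by norm_num

set_option maxHeartbeats 1000000 in
/-- A solution of `U'' = 2U - 8U³ + 6U⁵ + f` on a half-line which is uniformly close to the kink `h`
and agrees with it at the end point is close to it in `H¹`, with an error controlled by `f`. -/
theorem half_line_estimate {U V W h : ℝ → ℝ} {b : ℝ} (hU : IsACPrimitive U V)
    (hV : IsACPrimitive V W) (hh : ∀ x, HasDerivAt h (√2 * h x * (1 - h x ^ 2)) x)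
    (hpos : ∀ x, 0 < h x) (hlt : ∀ x, h x < 1) (hb : h b = 1 / 5) (hUb : U b = 1 / 5)
    (hge : ∀ x, b ≤ x → 1 / 5 ≤ h x) (hclose : ∀ x, b ≤ x → |U x - h x| ≤ 1 / 40)
    (hf : MemLp (fun x => W x - (2 * U x - 8 * U x ^ 3 + 6 * U x ^ 5)) 2
      (volume.restrict (Ioi b)))
    (hd : MemLp (fun x => U x - h x) 2 (volume.restrict (Ioi b)))
    (hd' : MemLp (fun x => V x - √2 * h x * (1 - h x ^ 2)) 2 (volume.restrict (Ioi b))) :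
    (V b - √2 * h b * (1 - h b ^ 2)) ^ 2
        ≤ 10 ^ 7 * ∫ x in Ioi b, (W x - (2 * U x - 8 * U x ^ 3 + 6 * U x ^ 5)) ^ 2 ∧
    ∫ x in Ioi b, (U x - h x) ^ 2
        ≤ 10 ^ 7 * ∫ x in Ioi b, (W x - (2 * U x - 8 * U x ^ 3 + 6 * U x ^ 5)) ^ 2 ∧
    ∫ x in Ioi b, (V x - √2 * h x * (1 - h x ^ 2)) ^ 2
        ≤ 10 ^ 7 * ∫ x in Ioi b, (W x - (2 * U x - 8 * U x ^ 3 + 6 * U x ^ 5)) ^ 2 := by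
  have c2 : √2 ^ 2 = 2 := Real.sq_sqrt (by norm_num)
  have c1 : 1 < √2 := by
    rw [Real.lt_sqrt (by norm_num)]; norm_num
  have c3 : √2 < 3 / 2 := by
    rw [Real.sqrt_lt' (by norm_num)]; norm_num
  have hhc : Continuous h := continuous_iff_continuousAt.2 fun x => (hh x).continuousAt
  have hUc := hU.continuous
  have hVc := hV.continuous
  set f : ℝ → ℝ := fun x => W x - (2 * U x - 8 * U x ^ 3 + 6 * U x ^ 5) with hfdef
  have hP : IsACPrimitive h (fun x => √2 * h x * (1 - h x ^ 2)) :=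
    .of_hasDerivAt hh (by fun_prop)
  -- The Bogomolny defect: it vanishes on exact kinks and satisfies `p' + √2 (1 - 3 U²) p = f`.
  set p : ℝ → ℝ := fun x => V x - √2 * U x * (1 - U x ^ 2) with hpdef
  set p' : ℝ → ℝ := fun x => f x - √2 * (1 - 3 * U x ^ 2) * p x with hp'def
  have hpP : IsACPrimitive p p' := by
    have := (hV.sub ((hU.mul ((IsACPrimitive.const 1).sub hU.sq)).const_mul √2))
    refine (show IsACPrimitive p _ by simpa only [hpdef, mul_assoc] using this).congr fun x => ?_
    simp only [hp'def, hpdef, hfdef]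
    linear_combination
      (-(U x - U x ^ 3) + 3 * U x ^ 2 * (U x - U x ^ 3)) * c2
  have hpc := hpP.continuous
  have hbd : ∀ x ∈ Ioi b, 7 / 40 ≤ U x ∧ U x ≤ 41 / 40 ∧ 1 / 5 ≤ h x ∧ h x < 1 := by
    intro x hx
    have h1 := abs_le.1 (hclose x (le_of_lt hx))
    have h2 := hge x (le_of_lt hx)
    have h3 := hlt x
    exact ⟨by linarith, by linarith, h2, h3⟩
  have hk : ∀ x ∈ Ioi b, |√2 * (1 - U x ^ 2 - U x * h x - h x ^ 2)| ≤ 6 := by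
    intro x hx
    obtain ⟨u1, u2, h1, h2⟩ := hbd x hx
    refine abs_sqrt_two_mul_le (abs_le.2 ⟨?_, ?_⟩) <;> nlinarith
  have hpd : ∀ x, p x = (V x - √2 * h x * (1 - h x ^ 2))
      - √2 * (1 - U x ^ 2 - U x * h x - h x ^ 2) * (U x - h x) := fun x => by
    simp only [hpdef]; ring
  have hpL : MemLp p 2 (volume.restrict (Ioi b)) := by
    rw [show p = _ from funext hpd]
    exact hd'.sub (memLp_continuous_mul_restrict measurableSet_Ioi (by fun_prop) hk hd)
  have hp'L : MemLp p' 2 (volume.restrict (Ioi b)) := by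
    refine hf.sub (memLp_continuous_mul_restrict (C := 6) measurableSet_Ioi (by fun_prop) ?_ hpL)
    intro x hx
    obtain ⟨u1, u2, h1, h2⟩ := hbd x hx
    refine abs_sqrt_two_mul_le (abs_le.2 ⟨?_, ?_⟩) <;> nlinarith
  have hpp' : IntegrableOn (fun x => p x * p' x) (Ioi b) := hpL.integrable_mul hp'L
  have hp2 : IntegrableOn (fun x => p x ^ 2) (Ioi b) := hpL.integrable_sq
  have hp'2 : IntegrableOn (fun x => p' x ^ 2) (Ioi b) := hp'L.integrable_sq
  have hf2 : IntegrableOn (fun x => f x ^ 2) (Ioi b) := hf.integrable_sq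
  have hd2 : IntegrableOn (fun x => (U x - h x) ^ 2) (Ioi b) := hd.integrable_sq
  -- the weighted energy identity
  set Q : ℝ → ℝ := fun x => √2 * (1 - 3 * h x ^ 2) with hQdef
  have hQc : Continuous Q := by fun_prop
  have hQ : IsACPrimitive Q (fun x => -12 * h x ^ 2 * (1 - h x ^ 2)) := by
    refine (((IsACPrimitive.const 1).sub (hP.sq.const_mul 3)).const_mul √2).congr fun x => ?_
    linear_combination (-6 * h x ^ 2 * (1 - h x ^ 2)) * c2
  have hz := hpP.sq.mul hQ
  have hQb : ∀ x ∈ Ioi b, |Q x| ≤ 6 := by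
    intro x hx
    obtain ⟨u1, u2, h1, h2⟩ := hbd x hx
    refine abs_sqrt_two_mul_le (abs_le.2 ⟨?_, ?_⟩) <;> nlinarith
  have hz'i : IntegrableOn (fun x => 2 * p x * p' x * Q x
      + p x ^ 2 * (-12 * h x ^ 2 * (1 - h x ^ 2))) (Ioi b) := by
    have i1 := integrableOn_continuous_mul_of_bound measurableSet_Ioi hQc hQb hpp'
    have i2 := integrableOn_continuous_mul_of_bound (k := fun x => -12 * h x ^ 2 * (1 - h x ^ 2))
      (C := 12) measurableSet_Ioi (by fun_prop) (fun x hx => by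
        obtain ⟨u1, u2, h1, h2⟩ := hbd x hx
        have := mul_nonneg (sq_nonneg (h x)) (by nlinarith : (0 : ℝ) ≤ 1 - h x ^ 2)
        rw [abs_le]; constructor <;> nlinarith) hp2
    refine ((i1.const_mul 2).add i2).congr ?_
    filter_upwards with x
    simp only [Pi.add_apply]
    ring
  have e1 := hz.integral_Ioi (b := b)
    ((integrableOn_continuous_mul_of_bound measurableSet_Ioi hQc hQb hp2).congr
      (ae_of_all _ fun x => mul_comm _ _)) hz'i
  have e2 := hpP.sq.integral_Ioi hp2 ((hpp'.const_mul 2).congr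
    (ae_of_all _ fun x => by ring))
  have hA0 : 0 ≤ ∫ x in Ioi b, p' x ^ 2 := integral_nonneg fun x => sq_nonneg _
  have hB0 : 0 ≤ ∫ x in Ioi b, p x ^ 2 := integral_nonneg fun x => sq_nonneg _
  have hF0 : 0 ≤ ∫ x in Ioi b, f x ^ 2 := integral_nonneg fun x => sq_nonneg _
  set A := ∫ x in Ioi b, p' x ^ 2 with hA
  set B := ∫ x in Ioi b, p x ^ 2 with hB
  set F := ∫ x in Ioi b, f x ^ 2 with hF
  have i3 : IntegrableOn (fun x => p' x ^ 2 + 2 * p x ^ 2) (Ioi b) := hp'2.add (hp2.const_mul 2)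
  -- Expand `(p' + Q p)²`. The cross term is completed to the derivative of `p² Q`, leaving `Q² - Q'
  -- = 2 + 6 h⁴` in front of `p²`. Moreover `p' + Q p` is `f` plus an error with factor `U² - h²`;
  -- its contribution `2 * 18 / 384` is below `1 / 10`.
  have e3 : A + 2 * B - p b ^ 2 * Q b ≤ 2 * F + 1 / 10 * B := by
    have := setIntegral_mono_on (i3.add hz'i)
      ((hf2.const_mul 2).add (hp2.const_mul (1 / 10))) measurableSet_Ioi (fun x hx => by
        obtain ⟨u1, u2, h1, h2⟩ := hbd x hx
        have h4 := sq_sub_sq_sq_le (hclose x (le_of_lt hx)) (by linarith) u2 (by linarith) h2.le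
        have h6 : p' x + Q x * p x = f x + √2 * 3 * (U x ^ 2 - h x ^ 2) * p x := by
          simp only [hp'def, hQdef]; ring
        have h7 : (p' x + Q x * p x) ^ 2 = p' x ^ 2 + (2 + 6 * h x ^ 4) * p x ^ 2
            + (2 * p x * p' x * Q x + p x ^ 2 * (-12 * h x ^ 2 * (1 - h x ^ 2))) := by
          simp only [hQdef]
          linear_combination (1 - 3 * h x ^ 2) ^ 2 * p x ^ 2 * c2
        have h8 : (√2 * 3 * (U x ^ 2 - h x ^ 2) * p x) ^ 2 ≤ 18 / 384 * p x ^ 2 := by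
          have : (√2 * 3 * (U x ^ 2 - h x ^ 2) * p x) ^ 2
              = 18 * ((U x ^ 2 - h x ^ 2) ^ 2 * p x ^ 2) := by
            linear_combination 9 * (U x ^ 2 - h x ^ 2) ^ 2 * p x ^ 2 * c2
          rw [this]
          linarith [mul_le_mul_of_nonneg_right h4 (sq_nonneg (p x))]
        simp only [Pi.add_apply]
        have h9 : 0 ≤ h x ^ 4 * p x ^ 2 := by positivity
        rw [h6] at h7
        have h10 := add_sq_le (a := f x) (b := √2 * 3 * (U x ^ 2 - h x ^ 2) * p x)
        have h11 := sq_nonneg (p x)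
        linarith)
    simp only [Pi.add_apply] at this
    rw [integral_add i3 hz'i, integral_add hp'2 (hp2.const_mul 2),
      integral_add (hf2.const_mul 2) (hp2.const_mul (1 / 10)), e1, integral_const_mul,
      integral_const_mul, integral_const_mul] at this
    linarith
  -- Trace inequality from `(p' + √2 p)² ≥ 0`. Since `Q b = √2 * (22 / 25)` with `22 / 25 < 1`, it
  -- absorbs the boundary term of `e3` and leaves `3 / 25` of the energy.
  have e4 : √2 * p b ^ 2 ≤ A + 2 * B := by
    have := setIntegral_mono_on (f := fun x => -√2 * (2 * p x * p' x))
      (g := fun x => p' x ^ 2 + 2 * p x ^ 2) (((hpp'.const_mul (2 * -√2))).congr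
        (ae_of_all _ fun x => by ring)) i3 measurableSet_Ioi
      (fun x hx => by nlinarith [sq_nonneg (p' x + √2 * p x)])
    rw [integral_const_mul, e2, integral_add hp'2 (hp2.const_mul 2), integral_const_mul] at this
    linarith
  have hQbv : Q b = √2 * (22 / 25) := by
    simp only [hQdef, hb]; norm_num
  rw [hQbv] at e3
  have hBF : B ≤ 15 * F := by linarith
  have hAF : A ≤ 17 * F := by linarith
  have hPF : p b ^ 2 ≤ 47 * F := by
    linarith [le_mul_of_one_le_left (sq_nonneg (p b)) c1.le]
  -- the weight `1 / h²`
  set ρ : ℝ → ℝ := fun x => (h x ^ 2)⁻¹ with hρdef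
  have hh0 : ∀ x, h x ^ 2 ≠ 0 := fun x => (pow_pos (hpos x) 2).ne'
  have hρc : Continuous ρ := (hhc.pow 2).inv₀ hh0
  have hρ : IsACPrimitive ρ (fun x => -(2 * √2) * (1 - h x ^ 2) * ρ x) := by
    refine .of_hasDerivAt (fun x => ?_) (by fun_prop)
    refine (((hh x).pow 2).inv (hh0 x)).congr_deriv ?_
    have := (hpos x).ne'
    simp only [hρdef]
    field_simp
    simp
    ring
  have hρb : ∀ x ∈ Ioi b, 1 ≤ ρ x ∧ ρ x ≤ 25 := by
    intro x hx
    obtain ⟨u1, u2, h1, h2⟩ := hbd x hx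
    constructor
    · exact (one_le_inv₀ (by positivity)).2 (by nlinarith)
    · exact inv_le_of_inv_le₀ (by norm_num) (by nlinarith)
  set d : ℝ → ℝ := fun x => U x - h x with hddef
  have hdc : Continuous d := by fun_prop
  have hdP := hU.sub hP
  -- `d' = p + √2 (1 - U² - U h - h²) d`. The logarithmic derivative of the weight cancels the
  -- growing part `√2 (1 - h²)`, so the remaining coefficient of `d²` is uniformly negative on the
  -- half-line.
  have hzz : IsACPrimitive (fun x => ρ x * d x ^ 2)
      (fun x => ρ x * (-(2 * √2) * (U x * (U x + h x)) * d x ^ 2 + 2 * (p x * d x))) := by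
    refine (hρ.mul hdP.sq).congr fun x => ?_
    rw [hpd x]
    simp only [hddef]
    ring
  have hpdi : IntegrableOn (fun x => p x * d x) (Ioi b) := hpL.integrable_mul hd
  have hρa : ∀ x ∈ Ioi b, |ρ x| ≤ 25 := fun x hx => by
    rw [abs_of_nonneg (by linarith [(hρb x hx).1])]; exact (hρb x hx).2
  have hzz' : IntegrableOn
      (fun x => ρ x * (-(2 * √2) * (U x * (U x + h x)) * d x ^ 2 + 2 * (p x * d x))) (Ioi b) := by
    refine integrableOn_continuous_mul_of_bound measurableSet_Ioi hρc hρa (Integrable.add ?_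
      (hpdi.const_mul 2))
    refine integrableOn_continuous_mul_of_bound (C := 9) measurableSet_Ioi (by fun_prop) ?_ hd2
    intro x hx
    obtain ⟨u1, u2, h1, h2⟩ := hbd x hx
    have h3 : 0 ≤ U x * (U x + h x) := by nlinarith
    have h4 : U x * (U x + h x) ≤ 3 := by nlinarith
    rw [abs_le]; constructor <;> nlinarith
  have e5 := hzz.integral_Ioi (integrableOn_continuous_mul_of_bound measurableSet_Ioi hρc hρa hd2)
    hzz'
  -- The matching at `b` removes the boundary term.
  rw [show d b = 0 by simp only [hddef]; rw [hUb, hb, sub_self]] at e5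
  have e6 : 9 / 100 * ∫ x in Ioi b, d x ^ 2 ≤ 300 * B := by
    have := setIntegral_mono_on hzz'
      ((hd2.const_mul (-(9 / 100))).add (hp2.const_mul 300)) measurableSet_Ioi (fun x hx => by
        obtain ⟨u1, u2, h1, h2⟩ := hbd x hx
        obtain ⟨r1, r2⟩ := hρb x hx
        have h3 : 13 / 200 ≤ U x * (U x + h x) := by nlinarith
        have h4 : 18 / 100 ≤ 2 * √2 * (U x * (U x + h x)) := by
          have : 7 / 5 ≤ √2 := by
            rw [Real.le_sqrt' (by norm_num)]; norm_num
          nlinarith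
        have h5 := two_mul_mul_le_add_sq_div (p x) (d x)
        have h6 : -(2 * √2) * (U x * (U x + h x)) * d x ^ 2 + 2 * (p x * d x)
            ≤ -(9 / 100) * d x ^ 2 + 100 / 9 * p x ^ 2 := by
          nlinarith [sq_nonneg (d x)]
        calc _ ≤ ρ x * (-(9 / 100) * d x ^ 2 + 100 / 9 * p x ^ 2) :=
              mul_le_mul_of_nonneg_left h6 (by linarith)
          _ ≤ _ := by
            simp only [Pi.add_apply]
            nlinarith [sq_nonneg (d x), sq_nonneg (p x)])
    simp only [Pi.add_apply] at this
    rw [e5, integral_add (hd2.const_mul _) (hp2.const_mul _), integral_const_mul,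
      integral_const_mul] at this
    linarith
  refine ⟨?_, by linarith, ?_⟩
  · have : V b - √2 * h b * (1 - h b ^ 2) = p b := by
      simp only [hpdef]; rw [hUb, hb]
    rw [this]; linarith
  · have := setIntegral_mono_on hd'.integrable_sq
      ((hp2.const_mul 2).add (hd2.const_mul 72)) measurableSet_Ioi (fun x hx => by
        have h1 := abs_le.1 (hk x hx)
        have h2 : (√2 * (1 - U x ^ 2 - U x * h x - h x ^ 2)) ^ 2 ≤ 36 := by nlinarith
        have h3 : V x - √2 * h x * (1 - h x ^ 2)
            = p x + √2 * (1 - U x ^ 2 - U x * h x - h x ^ 2) * d x := by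
          rw [hpd x]; ring
        have h4 : (√2 * (1 - U x ^ 2 - U x * h x - h x ^ 2) * d x) ^ 2 ≤ 36 * d x ^ 2 := by
          rw [mul_pow]; exact mul_le_mul_of_nonneg_right h2 (sq_nonneg _)
        rw [h3]
        simp only [Pi.add_apply]
        have h5 := add_sq_le (a := p x) (b := √2 * (1 - U x ^ 2 - U x * h x - h x ^ 2) * d x)
        linarith)
    simp only [Pi.add_apply] at this
    rw [integral_add (hp2.const_mul _) (hd2.const_mul _), integral_const_mul,
      integral_const_mul] at this
    linarith

/-! ### Explicit properties of the kinks. -/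

theorem kinkNegOneZero_eq (x : ℝ) : kinkNegOneZero x = -kinkZeroOne (-x) := by
  unfold kinkNegOneZero kinkZeroOne
  rw [neg_div, mul_neg, mul_neg]

theorem exp_two_mul_sqrt_two (x : ℝ) : Real.exp (2 * √2 * x) = Real.exp (√2 * x) ^ 2 := by
  rw [← Real.exp_nat_mul]; congr 1; push_cast; ring

theorem kinkZeroOne_pos (x : ℝ) : 0 < kinkZeroOne x := by
  unfold kinkZeroOne; positivity

theorem kinkZeroOne_sq_mul (x : ℝ) :
    kinkZeroOne x ^ 2 * (1 + Real.exp (√2 * x) ^ 2) = Real.exp (√2 * x) ^ 2 := by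
  unfold kinkZeroOne
  rw [div_pow, Real.sq_sqrt (by positivity), exp_two_mul_sqrt_two]
  field_simp

theorem kinkZeroOne_lt_one (x : ℝ) : kinkZeroOne x < 1 := by
  have h := kinkZeroOne_sq_mul x
  have h1 := kinkZeroOne_pos x
  by_contra! h2
  nlinarith [Real.exp_pos (√2 * x), mul_le_mul h2 h2 zero_le_one h1.le,
    sq_nonneg (Real.exp (√2 * x))]

theorem kinkZeroOne_le_exp (x : ℝ) : kinkZeroOne x ≤ Real.exp (√2 * x) := by
  refine div_le_self (Real.exp_pos _).le ?_
  rw [Real.one_le_sqrt]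
  linarith [Real.exp_pos (2 * √2 * x)]

theorem one_sub_kinkZeroOne_le_exp (x : ℝ) : 1 - kinkZeroOne x ≤ Real.exp (-(√2 * x)) := by
  have h := kinkZeroOne_sq_mul x
  have h1 := kinkZeroOne_pos x
  have h2 := kinkZeroOne_lt_one x
  have h3 := Real.exp_pos (√2 * x)
  rw [Real.exp_neg, ← one_div, le_div_iff₀ h3]
  set E := Real.exp (√2 * x)
  set k := kinkZeroOne x
  have h4 : (1 - k) * (1 + E ^ 2) ≤ 1 := by nlinarith [sq_nonneg E]
  nlinarith [sq_nonneg (E - 1)]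

theorem hasDerivAt_kinkZeroOne (x : ℝ) :
    HasDerivAt kinkZeroOne (√2 * kinkZeroOne x * (1 - kinkZeroOne x ^ 2)) x := by
  have h1 : HasDerivAt (fun x => Real.exp (√2 * x)) (Real.exp (√2 * x) * √2) x := by
    simpa using ((hasDerivAt_id x).const_mul √2).exp
  have h2 : HasDerivAt (fun x => √(1 + Real.exp (2 * √2 * x)))
      (Real.exp (2 * √2 * x) * (2 * √2) / (2 * √(1 + Real.exp (2 * √2 * x)))) x := by
    have := (((hasDerivAt_id x).const_mul (2 * √2)).exp.const_add 1).sqrt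
      (by simpa using (by positivity : (1 + Real.exp (2 * √2 * x)) ≠ 0))
    simpa using this
  have hS : √(1 + Real.exp (2 * √2 * x)) ≠ 0 := by positivity
  have hS2 : √(1 + Real.exp (2 * √2 * x)) ^ 2 = 1 + Real.exp (2 * √2 * x) :=
    Real.sq_sqrt (by positivity)
  refine (h1.div h2 hS).congr_deriv ?_
  unfold kinkZeroOne
  rw [exp_two_mul_sqrt_two] at hS hS2 ⊢
  generalize √(1 + Real.exp (√2 * x) ^ 2) = S at *
  field_simp

theorem continuous_kinkZeroOne : Continuous kinkZeroOne :=
  continuous_iff_continuousAt.2 fun x => (hasDerivAt_kinkZeroOne x).continuousAt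

theorem monotone_kinkZeroOne : Monotone kinkZeroOne := by
  refine monotone_of_hasDerivAt_nonneg hasDerivAt_kinkZeroOne fun x => ?_
  have h1 := kinkZeroOne_pos x
  have h2 := kinkZeroOne_lt_one x
  have : 0 ≤ 1 - kinkZeroOne x ^ 2 := by nlinarith
  simp only [Pi.zero_apply]
  positivity

theorem exists_kinkZeroOne_eq_fifth : ∃ x, kinkZeroOne x = 1 / 5 := by
  refine ⟨-Real.log 24 / (2 * √2), ?_⟩
  have h2 : 0 < √2 := by positivity
  have h := kinkZeroOne_sq_mul (-Real.log 24 / (2 * √2))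
  rw [← exp_two_mul_sqrt_two, mul_div_cancel₀ _ (by positivity), Real.exp_neg,
    Real.exp_log (by norm_num)] at h
  nlinarith [kinkZeroOne_pos (-Real.log 24 / (2 * √2))]

theorem exp_sq_of_kinkZeroOne_eq_fifth {x : ℝ} (hx : kinkZeroOne x = 1 / 5) :
    Real.exp (√2 * x) ^ 2 = 1 / 24 := by
  have h := kinkZeroOne_sq_mul x
  rw [hx] at h
  linarith

/-- Fixing the translate by its value at one point controls it everywhere. In the variable `k² / (1
- k²) = e^{2√2 x}` a translation is a multiplication, so a small relative error at one point is the
same small relative error at all points. -/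
theorem abs_kinkZeroOne_sub_le {X X' : ℝ} (hX : kinkZeroOne X = 1 / 5)
    (hX' : |kinkZeroOne X' - 1 / 5| ≤ 1 / 2000) (t : ℝ) :
    |kinkZeroOne (X' + t) - kinkZeroOne (X + t)| ≤ 1 / 80 := by
  have hE := exp_sq_of_kinkZeroOne_eq_fifth hX
  have h' := kinkZeroOne_sq_mul X'
  obtain ⟨l1, l2⟩ := abs_le.1 hX'
  set k := kinkZeroOne X'
  set T := Real.exp (√2 * X') ^ 2 with hT
  have hT0 : 0 < T := by positivity
  have k1 : k ^ 2 ≤ (401 / 2000) ^ 2 := pow_le_pow_left₀ (by linarith) (by linarith) 2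
  have k2 : (399 / 2000) ^ 2 ≤ k ^ 2 := pow_le_pow_left₀ (by norm_num) (by linarith) 2
  have T1 : T * 24 - 1 ≤ 1 / 80 := by nlinarith
  have T2 : -(1 / 80) ≤ T * 24 - 1 := by nlinarith
  have ha := kinkZeroOne_sq_mul (X + t)
  have ha' := kinkZeroOne_sq_mul (X' + t)
  have he : ∀ Y, Real.exp (√2 * (Y + t)) ^ 2
      = Real.exp (√2 * Y) ^ 2 * Real.exp (√2 * t) ^ 2 := fun Y => by
    rw [mul_add, Real.exp_add, mul_pow]
  rw [he, hE] at ha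
  rw [he, ← hT] at ha'
  have a0 := kinkZeroOne_pos (X + t)
  have a0' := kinkZeroOne_pos (X' + t)
  have a1 := kinkZeroOne_lt_one (X + t)
  have hs : 0 < Real.exp (√2 * t) ^ 2 := by positivity
  set a := kinkZeroOne (X + t)
  set a' := kinkZeroOne (X' + t)
  set s := Real.exp (√2 * t) ^ 2
  -- `T * 24` is the ratio of the two exponentials, hence `1` for identical translates.
  have key : (a' - a) * (a' + a) * (1 + T * s) = (T * 24 - 1) * a ^ 2 := by
    linear_combination ha' - 24 * T * ha
  have hm : a ≤ (a' + a) * (1 + T * s) := by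
    have : 0 < T * s := by positivity
    nlinarith
  have key2 : |a' - a| * ((a' + a) * (1 + T * s)) = |T * 24 - 1| * a ^ 2 := by
    have := congrArg abs key
    rwa [mul_assoc, abs_mul, abs_mul _ (a ^ 2),
      abs_of_pos (by positivity : 0 < (a' + a) * (1 + T * s)),
      abs_of_pos (by positivity : 0 < a ^ 2)] at this
  have hT' : |T * 24 - 1| ≤ 1 / 80 := abs_le.2 ⟨T2, T1⟩
  have h5 : |a' - a| * a ≤ 1 / 80 * a * a := by
    calc |a' - a| * a ≤ |a' - a| * ((a' + a) * (1 + T * s)) :=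
          mul_le_mul_of_nonneg_left hm (abs_nonneg _)
      _ = |T * 24 - 1| * a ^ 2 := key2
      _ ≤ 1 / 80 * a ^ 2 := mul_le_mul_of_nonneg_right hT' (by positivity)
      _ = _ := by ring
  have := le_of_mul_le_mul_right h5 a0
  linarith

/-! ### Sobolev embedding and square integrability from exponential decay. -/

/-- Integrate `-(g²)' = -2 g g' ≤ g² + g'²` from `x` to infinity. -/
theorem IsACPrimitive.sq_le_integral {g g' : ℝ → ℝ} (h : IsACPrimitive g g') (hg : MemLp g 2)
    (hg' : MemLp g' 2) (x : ℝ) : g x ^ 2 ≤ (∫ t, g t ^ 2) + ∫ t, g' t ^ 2 := by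
  have i1 : Integrable fun t => g t ^ 2 := hg.integrable_sq
  have i2 : Integrable fun t => g' t ^ 2 := hg'.integrable_sq
  have i3 : Integrable fun t => 2 * g t * g' t := by
    simpa only [mul_assoc, Pi.mul_apply] using (hg.integrable_mul hg').const_mul 2
  have e := h.sq.integral_Ioi (b := x) i1.integrableOn i3.integrableOn
  have m1 : ∫ t in Ioi x, -(2 * g t * g' t) ≤ ∫ t in Ioi x, (g t ^ 2 + g' t ^ 2) :=
    setIntegral_mono_on i3.neg.integrableOn (i1.add i2).integrableOn measurableSet_Ioi
      fun t _ => by nlinarith [sq_nonneg (g t + g' t)]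
  have m2 : ∫ t in Ioi x, (g t ^ 2 + g' t ^ 2) ≤ ∫ t, (g t ^ 2 + g' t ^ 2) :=
    setIntegral_le_integral (i1.add i2) (ae_of_all _ fun t => by positivity)
  rw [integral_neg, e] at m1
  rw [integral_add i1 i2] at m2
  linarith

theorem integrableOn_Ioi_sq_of_exp_decay {k : ℝ → ℝ} (hk : Continuous k) {b D c : ℝ} (hc : 1 / 2 ≤ c)
    (h : ∀ x, b ≤ x → |k x| ≤ D * Real.exp (-(c * (x - b)))) :
    IntegrableOn (fun x => k x ^ 2) (Ioi b) ∧ ∫ x in Ioi b, k x ^ 2 ≤ D ^ 2 := by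
  have hi := (integrableOn_exp_mul_Ioi (a := -(2 * c)) (by linarith) b).const_mul
    (D ^ 2 * Real.exp (2 * c * b))
  have hle : ∀ x ∈ Ioi b, k x ^ 2 ≤ D ^ 2 * Real.exp (2 * c * b) * Real.exp (-(2 * c) * x) := by
    intro x hx
    have h1 := pow_le_pow_left₀ (abs_nonneg _) (h x (le_of_lt hx)) 2
    rw [sq_abs, mul_pow, ← Real.exp_nat_mul] at h1
    rw [mul_assoc, ← Real.exp_add]
    refine h1.trans_eq ?_
    congr 2
    push_cast
    ring
  have hii : IntegrableOn (fun x => k x ^ 2) (Ioi b) := by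
    refine Integrable.mono' hi (hk.pow 2).aestronglyMeasurable ?_
    filter_upwards [ae_restrict_mem measurableSet_Ioi] with x hx
    rw [Real.norm_eq_abs, abs_of_nonneg (sq_nonneg _)]
    exact hle x hx
  refine ⟨hii, (setIntegral_mono_on hii hi measurableSet_Ioi hle).trans ?_⟩
  rw [integral_const_mul, integral_exp_mul_Ioi (by linarith), mul_assoc, neg_div_neg_eq,
    ← mul_div_assoc, ← Real.exp_add, show 2 * c * b + -(2 * c) * b = 0 by ring, Real.exp_zero]
  refine mul_le_of_le_one_right (sq_nonneg _) ?_
  rw [div_le_one (by linarith)]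
  linarith

theorem memLp_two_of_exp_decay {k : ℝ → ℝ} (hk : Continuous k) {D c : ℝ} (hc : 1 / 2 ≤ c)
    (h : ∀ x, |k x| ≤ D * Real.exp (-(c * |x|))) : MemLp k 2 := by
  rw [memLp_two_iff_integrable_sq hk.aestronglyMeasurable, ← integrableOn_univ,
    ← Iic_union_Ioi (a := (0 : ℝ))]
  have h1 : IntegrableOn (fun x => k x ^ 2) (Ioi 0) := by
    refine (integrableOn_Ioi_sq_of_exp_decay (D := D) hk hc fun x hx => ?_).1
    have := h x
    rw [sub_zero]
    rwa [abs_of_nonneg hx] at this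
  have h2 : IntegrableOn (fun x => k (-x) ^ 2) (Ioi 0) := by
    refine (integrableOn_Ioi_sq_of_exp_decay (k := fun x => k (-x)) (D := D) (by fun_prop) hc
      fun x hx => ?_).1
    have := h (-x)
    rw [sub_zero]
    rwa [abs_neg, abs_of_nonneg hx] at this
  refine IntegrableOn.union ?_ h1
  rw [integrableOn_Iic_iff_integrableOn_Iio]
  rw [← neg_zero] at h2
  simpa only [neg_neg] using h2.comp_neg_Iio

/-! ### The interval between the kinks: its length and the energy on it. -/

theorem integral_exp_two_mul_le {c l b : ℝ} (hc : 1 / 2 ≤ c) (s : ℝ) :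
    ∫ x in s..b, Real.exp (c * (x - l)) ^ 2 ≤ Real.exp (c * (b - l)) ^ 2 := by
  have hd : ∀ x, HasDerivAt (fun x => (2 * c)⁻¹ * Real.exp (c * (x - l)) ^ 2)
      (Real.exp (c * (x - l)) ^ 2) x := fun x => by
    have h1 : HasDerivAt (fun x => Real.exp (c * (x - l))) (Real.exp (c * (x - l)) * c) x := by
      simpa using (((hasDerivAt_id x).sub_const l).const_mul c).exp
    refine ((h1.pow 2).const_mul (2 * c)⁻¹).congr_deriv ?_
    have : c ≠ 0 := by linarith
    field_simp
    ring
  rw [intervalIntegral.integral_eq_sub_of_hasDerivAt (fun x _ => hd x)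
    ((by fun_prop : Continuous fun x => Real.exp (c * (x - l)) ^ 2).intervalIntegrable _ _)]
  have h2 : (2 * c)⁻¹ ≤ 1 := inv_le_one_of_one_le₀ (by linarith)
  have h3 : 0 ≤ (2 * c)⁻¹ * Real.exp (c * (s - l)) ^ 2 := by
    have : 0 ≤ (2 * c)⁻¹ := inv_nonneg.2 (by linarith)
    positivity
  have h4 := mul_le_of_le_one_left (sq_nonneg (Real.exp (c * (b - l)))) h2
  linarith

/-- If the Bogomolny defect `V - w(U)` is small at `b` and bounded below at `s`, then
`[s, b]` is long, quantitatively in terms of the size of the defect. -/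
theorem exp_neg_length_le {U V W : ℝ → ℝ} {s b K Φ : ℝ} (hsb : s ≤ b) (hU : IsACPrimitive U V)
    (hV : IsACPrimitive V W)
    (hf : Integrable fun x => (W x - (2 * U x - 8 * U x ^ 3 + 6 * U x ^ 5)) ^ 2)
    (hΦ : 0 < Φ) (hfΦ : ∫ x, (W x - (2 * U x - 8 * U x ^ 3 + 6 * U x ^ 5)) ^ 2 ≤ Φ ^ 2)
    (hK : 1 ≤ K) (hb : |V b - √2 * U b * (1 - U b ^ 2)| ≤ K * Φ)
    (hs : 1 / 2 - K * Φ ≤ V s - √2 * U s * (1 - U s ^ 2)) :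
    Real.exp (-(√2 * (b - s))) ≤ 6 * K * Φ := by
  have c2 : √2 ^ 2 = 2 := Real.sq_sqrt (by norm_num)
  have c1 : 1 < √2 := by
    rw [Real.lt_sqrt (by norm_num)]; norm_num
  have hUc := hU.continuous
  have hVc := hV.continuous
  set f : ℝ → ℝ := fun x => W x - (2 * U x - 8 * U x ^ 3 + 6 * U x ^ 5) with hfdef
  set p : ℝ → ℝ := fun x => V x - √2 * U x * (1 - U x ^ 2) with hpdef
  have hpP : IsACPrimitive p (fun x => f x - √2 * (1 - 3 * U x ^ 2) * p x) := by
    have := (hV.sub ((hU.mul ((IsACPrimitive.const 1).sub hU.sq)).const_mul √2))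
    refine (show IsACPrimitive p _ by simpa only [hpdef, mul_assoc] using this).congr fun x => ?_
    simp only [hpdef, hfdef]
    linear_combination
      (-(U x - U x ^ 3) + 3 * U x ^ 2 * (U x - U x ^ 3)) * c2
  -- `e^J` is the integrating factor of the equation for `p`; `1 - 3 U² ≤ 1` bounds its growth rate
  -- by `√2`.
  set J : ℝ → ℝ := fun x => ∫ t in s..x, √2 * (1 - 3 * U t ^ 2) with hJdef
  have hkc : Continuous fun t => √2 * (1 - 3 * U t ^ 2) := by fun_prop
  have hJd : ∀ x, HasDerivAt J (√2 * (1 - 3 * U x ^ 2)) x := fun x =>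
    intervalIntegral.integral_hasDerivAt_right (hkc.intervalIntegrable _ _)
      hkc.stronglyMeasurable.stronglyMeasurableAtFilter hkc.continuousAt
  have hJc : Continuous J := continuous_iff_continuousAt.2 fun x => (hJd x).continuousAt
  have hI : IsACPrimitive (fun x => Real.exp (J x))
      (fun x => Real.exp (J x) * (√2 * (1 - 3 * U x ^ 2))) :=
    .of_hasDerivAt (fun x => (hJd x).exp) (by fun_prop)
  have hIp : IsACPrimitive (fun x => Real.exp (J x) * p x) (fun x => Real.exp (J x) * f x) :=
    (hI.mul hpP).congr fun x => by ring
  have hJle : ∀ x, s ≤ x → J x ≤ √2 * (x - s) := by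
    intro x hx
    have := intervalIntegral.integral_mono_on (μ := volume) hx (hkc.intervalIntegrable s x)
      (continuous_const (y := √2) |>.intervalIntegrable s x)
      (fun t _ => by nlinarith [mul_nonneg (by linarith : (0 : ℝ) ≤ √2) (sq_nonneg (U t))])
    rw [intervalIntegral.integral_const, smul_eq_mul] at this
    linarith
  set E := Real.exp (√2 * (b - s)) with hE
  have hE1 : 1 ≤ E := Real.one_le_exp (by nlinarith)
  have hf2 : IntervalIntegrable (fun x => f x ^ 2) volume s b := hf.intervalIntegrable
  have hfs : ∫ x in s..b, f x ^ 2 ≤ Φ ^ 2 := by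
    rw [intervalIntegral.integral_of_le hsb]
    exact (setIntegral_le_integral hf (ae_of_all _ fun x => sq_nonneg _)).trans hfΦ
  have he2 := integral_exp_two_mul_le (c := √2) (l := s) (b := b) (by linarith) s
  have hec : IntervalIntegrable (fun x => Real.exp (√2 * (x - s)) ^ 2) volume s b :=
    (by fun_prop : Continuous fun x => Real.exp (√2 * (x - s)) ^ 2).intervalIntegrable _ _
  -- Cauchy–Schwarz in the form of Young's inequality, with weights `Φ / (2E)` and `E / (2Φ)` chosen
  -- so that both terms equal `EΦ / 2`. The division by `Φ` is one place where `0 < Φ` is needed.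
  have hbound : -(E * Φ) ≤ ∫ x in s..b, Real.exp (J x) * f x := by
    have h1 := intervalIntegral.integral_mono_on hsb
      (((hec.const_mul (Φ / (2 * E))).add (hf2.const_mul (E / (2 * Φ)))).neg)
      (hIp.intervalIntegrable s b) (fun x hx => by
        have h2 : Real.exp (J x) ≤ Real.exp (√2 * (x - s)) := Real.exp_le_exp.2 (hJle x hx.1)
        have h3 := pow_le_pow_left₀ (Real.exp_pos (J x)).le h2 2
        have hEΦ : 0 < 2 * E * Φ := by positivity
        have h4 : -(Φ / (2 * E) * Real.exp (J x) ^ 2 + E / (2 * Φ) * f x ^ 2)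
            ≤ Real.exp (J x) * f x := by
          have : Real.exp (J x) * f x + (Φ / (2 * E) * Real.exp (J x) ^ 2 + E / (2 * Φ) * f x ^ 2)
              = (Φ * Real.exp (J x) + E * f x) ^ 2 / (2 * E * Φ) := by
            field_simp
            ring
          have h5 : 0 ≤ (Φ * Real.exp (J x) + E * f x) ^ 2 / (2 * E * Φ) := by positivity
          linarith
        refine le_trans ?_ h4
        have := mul_le_mul_of_nonneg_left h3 (by positivity : 0 ≤ Φ / (2 * E))
        simp only [Pi.neg_apply]
        linarith)
    refine le_trans ?_ h1
    simp only [Pi.neg_apply]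
    rw [intervalIntegral.integral_neg, intervalIntegral.integral_add (hec.const_mul _)
      (hf2.const_mul _), intervalIntegral.integral_const_mul, intervalIntegral.integral_const_mul]
    have h6 := mul_le_mul_of_nonneg_left he2 (by positivity : 0 ≤ Φ / (2 * E))
    have h7 := mul_le_mul_of_nonneg_left hfs (by positivity : 0 ≤ E / (2 * Φ))
    have h8 : Φ / (2 * E) * E ^ 2 = E * Φ / 2 := by field_simp
    have h9 : E / (2 * Φ) * Φ ^ 2 = E * Φ / 2 := by field_simp
    rw [← hE, h8] at h6
    rw [h9] at h7
    linarith
  rw [hIp.integral_eq_sub, show J s = 0 by simp [hJdef], Real.exp_zero, one_mul] at hbound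
  have h10 : Real.exp (J b) * p b ≤ E * (K * Φ) :=
    calc Real.exp (J b) * p b ≤ Real.exp (J b) * (K * Φ) :=
          mul_le_mul_of_nonneg_left (abs_le.1 hb).2 (Real.exp_pos _).le
      _ ≤ E * (K * Φ) :=
          mul_le_mul_of_nonneg_right (Real.exp_le_exp.2 (hJle b hsb)) (by positivity)
  have hs' : 1 / 2 - K * Φ ≤ p s := hs
  rw [Real.exp_neg, ← hE, inv_le_iff_one_le_mul₀ (by positivity)]
  have h11 : K * Φ ≤ E * (K * Φ) := le_mul_of_one_le_left (by positivity) hE1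
  have h12 : E * Φ ≤ E * (K * Φ) :=
    mul_le_mul_of_nonneg_left (le_mul_of_one_le_left hΦ.le hK) (by positivity)
  linarith

/-- Strong monotonicity near the vacuum `0`, where the derivative `2 - 24 u² + 30 u⁴` of the
nonlinearity is at least `1 / 2`. It makes the energy between the kinks coercive. -/
theorem nonlinearity_sub_mul_ge {u v : ℝ} (hu : |u| ≤ 1 / 4) (hv : |v| ≤ 1 / 4) :
    1 / 2 * (u - v) ^ 2 ≤ (u - v) *
      ((2 * u - 8 * u ^ 3 + 6 * u ^ 5) - (2 * v - 8 * v ^ 3 + 6 * v ^ 5)) := by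
  have hu2 : u ^ 2 ≤ 1 / 16 := by rw [← sq_abs]; nlinarith [abs_nonneg u]
  have hv2 : v ^ 2 ≤ 1 / 16 := by rw [← sq_abs]; nlinarith [abs_nonneg v]
  have h1 : (u - v) * ((2 * u - 8 * u ^ 3 + 6 * u ^ 5) - (2 * v - 8 * v ^ 3 + 6 * v ^ 5))
      = (u - v) ^ 2 * (2 - 8 * (u ^ 2 + u * v + v ^ 2)
        + 6 * (u ^ 4 + u ^ 3 * v + u ^ 2 * v ^ 2 + u * v ^ 3 + v ^ 4)) := by ring
  have h2 : 0 ≤ u ^ 4 + u ^ 3 * v + u ^ 2 * v ^ 2 + u * v ^ 3 + v ^ 4 := by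
    nlinarith [sq_nonneg (u ^ 2 + u * v / 2), sq_nonneg (v ^ 2 + u * v / 2),
      sq_nonneg (u * v)]
  have h3 : u ^ 2 + u * v + v ^ 2 ≤ 3 / 16 := by nlinarith [sq_nonneg (u - v)]
  rw [h1, mul_comm]
  exact mul_le_mul_of_nonneg_left (by linarith) (sq_nonneg _)

/-- The `L²` estimate of the kink interaction term. -/
theorem interaction_sq_le {a c D : ℝ} (ha0 : 0 ≤ a) (ha : a ≤ 1 / 5) (hc0 : 0 ≤ c)
    (hc : c ≤ 1 / 5) (hD : a * c ≤ D) :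
    ((2 * (a - c) - 8 * (a - c) ^ 3 + 6 * (a - c) ^ 5) - (2 * a - 8 * a ^ 3 + 6 * a ^ 5)
      + (2 * c - 8 * c ^ 3 + 6 * c ^ 5)) ^ 2 ≤ 576 * D ^ 2 * (a ^ 2 + c ^ 2) := by
  have h1 : (2 * (a - c) - 8 * (a - c) ^ 3 + 6 * (a - c) ^ 5) - (2 * a - 8 * a ^ 3 + 6 * a ^ 5)
      + (2 * c - 8 * c ^ 3 + 6 * c ^ 5)
      = (a * c) * (a - c) * (24 - 30 * (a ^ 2 - a * c + c ^ 2)) := by ring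
  have h0 : 0 ≤ a * c := mul_nonneg ha0 hc0
  have h2 : (a * c) ^ 2 ≤ D ^ 2 := pow_le_pow_left₀ h0 hD 2
  have h3 : (a - c) ^ 2 ≤ a ^ 2 + c ^ 2 := by nlinarith
  have h4 : (24 - 30 * (a ^ 2 - a * c + c ^ 2)) ^ 2 ≤ 24 ^ 2 := by
    have : 0 ≤ a ^ 2 - a * c + c ^ 2 := by nlinarith [sq_nonneg (a - c)]
    have : a ^ 2 - a * c + c ^ 2 ≤ 2 / 25 := by nlinarith
    exact pow_le_pow_left₀ (by linarith) (by linarith) 2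
  rw [h1, mul_pow, mul_pow]
  calc (a * c) ^ 2 * (a - c) ^ 2 * (24 - 30 * (a ^ 2 - a * c + c ^ 2)) ^ 2
      ≤ D ^ 2 * (a ^ 2 + c ^ 2) * 24 ^ 2 :=
        mul_le_mul (mul_le_mul h2 h3 (sq_nonneg _) (sq_nonneg _)) h4 (sq_nonneg _)
          (by positivity)
    _ = _ := by ring

set_option maxHeartbeats 1000000 in
/-- The energy estimate in the region between the two kinks. -/
theorem middle_estimate {U V W a c : ℝ → ℝ} {s b K Φ : ℝ} (hsb : s ≤ b) (hU : IsACPrimitive U V)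
    (hV : IsACPrimitive V W)
    (hf : Integrable fun x => (W x - (2 * U x - 8 * U x ^ 3 + 6 * U x ^ 5)) ^ 2)
    (hΦ : 0 < Φ) (hfΦ : ∫ x, (W x - (2 * U x - 8 * U x ^ 3 + 6 * U x ^ 5)) ^ 2 ≤ Φ ^ 2)
    (ha' : ∀ x, HasDerivAt a (√2 * a x * (1 - a x ^ 2)) x)
    (hc' : ∀ x, HasDerivAt c (-(√2 * c x * (1 - c x ^ 2))) x)
    (ha0 : ∀ x, 0 < a x) (hc0 : ∀ x, 0 < c x)
    (ha : ∀ x ∈ Icc s b, a x ≤ 1 / 5) (hc : ∀ x ∈ Icc s b, c x ≤ 1 / 5)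
    (hae : ∀ x, a x ≤ Real.exp (√2 * (x - b))) (hce : ∀ x, c x ≤ Real.exp (-√2 * (x - s)))
    (hUm : ∀ x ∈ Icc s b, |U x| ≤ 1 / 4) (hUb : U b = a b) (hUs : U s = -c s)
    (hK : 1 ≤ K) (hb : |V b - √2 * a b * (1 - a b ^ 2)| ≤ K * Φ)
    (hs : |V s - √2 * c s * (1 - c s ^ 2)| ≤ K * Φ) :
    (∫ x in s..b, (U x - a x + c x) ^ 2)
      + ∫ x in s..b, (V x - √2 * a x * (1 - a x ^ 2) - √2 * c x * (1 - c x ^ 2)) ^ 2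
      ≤ 4 * (2 * Φ ^ 2 + 2304 * Real.exp (-(√2 * (b - s))) ^ 2
        + 2 * Real.exp (-(√2 * (b - s))) * (K * Φ + 2 * Real.exp (-(√2 * (b - s))))) := by
  have c2 : √2 ^ 2 = 2 := Real.sq_sqrt (by norm_num)
  have c1 : 1 < √2 := by
    rw [Real.lt_sqrt (by norm_num)]; norm_num
  have c3 : √2 < 3 / 2 := by
    rw [Real.sqrt_lt' (by norm_num)]; norm_num
  have hUc := hU.continuous
  have hVc := hV.continuous
  have hac : Continuous a := continuous_iff_continuousAt.2 fun x => (ha' x).continuousAt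
  have hcc : Continuous c := continuous_iff_continuousAt.2 fun x => (hc' x).continuousAt
  set D := Real.exp (-(√2 * (b - s))) with hD
  have hD0 : 0 < D := Real.exp_pos _
  set f : ℝ → ℝ := fun x => W x - (2 * U x - 8 * U x ^ 3 + 6 * U x ^ 5) with hfdef
  have aP : IsACPrimitive a (fun x => √2 * a x * (1 - a x ^ 2)) := .of_hasDerivAt ha' (by fun_prop)
  have cP : IsACPrimitive c (fun x => -(√2 * c x * (1 - c x ^ 2))) :=
    .of_hasDerivAt hc' (by fun_prop)
  have a2P : IsACPrimitive (fun x => √2 * a x * (1 - a x ^ 2))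
      (fun x => 2 * a x - 8 * a x ^ 3 + 6 * a x ^ 5) := by
    have := ((aP.mul ((IsACPrimitive.const 1).sub aP.sq)).const_mul √2)
    simp only [← mul_assoc] at this
    refine this.congr fun x => ?_
    linear_combination (a x - 4 * a x ^ 3 + 3 * a x ^ 5) * c2
  have c2P : IsACPrimitive (fun x => √2 * c x * (1 - c x ^ 2))
      (fun x => -(2 * c x - 8 * c x ^ 3 + 6 * c x ^ 5)) := by
    have := ((cP.mul ((IsACPrimitive.const 1).sub cP.sq)).const_mul √2)
    simp only [← mul_assoc] at this
    refine this.congr fun x => ?_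
    linear_combination (-(c x - 4 * c x ^ 3 + 3 * c x ^ 5)) * c2
  set g : ℝ → ℝ := fun x => U x - a x + c x with hgdef
  set g' : ℝ → ℝ := fun x => V x - √2 * a x * (1 - a x ^ 2) - √2 * c x * (1 - c x ^ 2) with hg'def
  have hgc : Continuous g := by fun_prop
  have hg'c : Continuous g' := by fun_prop
  have gP : IsACPrimitive g g' := ((hU.sub aP).add cP).congr fun x => by
    simp only [hg'def]; ring
  have g2P := ((hV.sub a2P).sub c2P)
  have hprod := gP.mul g2P
  set G : ℝ → ℝ := fun x => 576 * D ^ 2 *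
    (Real.exp (√2 * (x - b)) ^ 2 + Real.exp (-√2 * (x - s)) ^ 2) with hG
  have hGc : Continuous G := by fun_prop
  have hf2 : IntervalIntegrable (fun x => f x ^ 2) volume s b := hf.intervalIntegrable
  have hfs : ∫ x in s..b, f x ^ 2 ≤ Φ ^ 2 := by
    rw [intervalIntegral.integral_of_le hsb]
    exact (setIntegral_le_integral hf (ae_of_all _ fun x => sq_nonneg _)).trans hfΦ
  have ig : IntervalIntegrable (fun x => g x ^ 2) volume s b :=
    (hgc.pow 2).intervalIntegrable _ _
  have ig' : IntervalIntegrable (fun x => g' x ^ 2) volume s b :=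
    (hg'c.pow 2).intervalIntegrable _ _
  have iG := hGc.intervalIntegrable (μ := volume) s b
  have i1 : IntervalIntegrable (fun x => g' x ^ 2 + 1 / 4 * g x ^ 2) volume s b :=
    ig'.add (ig.const_mul _)
  have i2 : IntervalIntegrable (fun x => 2 * f x ^ 2 + 2 * G x) volume s b :=
    (hf2.const_mul _).add (iG.const_mul _)
  -- Differentiate `g g'`. Monotonicity gives `g² / 2`, half of which absorbs the product of `g`
  -- with `f` and the interaction term `R`; the pointwise bound `a c ≤ D` makes `R` small in `L²`.
  have hmono := intervalIntegral.integral_mono_on hsb (i1.sub i2)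
    (hprod.intervalIntegrable s b) (fun x hx => by
      have hDx : a x * c x ≤ D := by
        refine (mul_le_mul (hae x) (hce x) (hc0 x).le (Real.exp_pos _).le).trans_eq ?_
        rw [← Real.exp_add, hD]
        congr 1; ring
      have e1 := interaction_sq_le (ha0 x).le (ha x hx) (hc0 x).le (hc x hx) hDx
      have e2 : a x ^ 2 + c x ^ 2
          ≤ Real.exp (√2 * (x - b)) ^ 2 + Real.exp (-√2 * (x - s)) ^ 2 :=
        add_le_add (pow_le_pow_left₀ (ha0 x).le (hae x) 2) (pow_le_pow_left₀ (hc0 x).le (hce x) 2)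
      have e3 := e1.trans (mul_le_mul_of_nonneg_left e2 (by positivity : 0 ≤ 576 * D ^ 2))
      have e4 := nonlinearity_sub_mul_ge (hUm x hx) (v := a x - c x) (by
        have h1 := ha0 x
        have h2 := hc0 x
        have h3 := ha x hx
        have h4 := hc x hx
        rw [abs_le]; constructor <;> linarith)
      rw [show U x - (a x - c x) = g x by simp only [hgdef]; ring] at e4
      change _ ≤ G x at e3
      set R := (2 * (a x - c x) - 8 * (a x - c x) ^ 3 + 6 * (a x - c x) ^ 5)
        - (2 * a x - 8 * a x ^ 3 + 6 * a x ^ 5) + (2 * c x - 8 * c x ^ 3 + 6 * c x ^ 5) with hR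
      have e5 : W x - (2 * a x - 8 * a x ^ 3 + 6 * a x ^ 5)
          - -(2 * c x - 8 * c x ^ 3 + 6 * c x ^ 5)
          = ((2 * U x - 8 * U x ^ 3 + 6 * U x ^ 5) - (2 * (a x - c x) - 8 * (a x - c x) ^ 3
            + 6 * (a x - c x) ^ 5)) + (f x + R) := by
        simp only [hfdef, hR]; ring
      have e6 : g' x = V x - √2 * a x * (1 - a x ^ 2) - √2 * c x * (1 - c x ^ 2) := rfl
      rw [e5, ← e6, mul_add (g x)]
      have e7 : -(1 / 4 * g x ^ 2 + (f x + R) ^ 2) ≤ g x * (f x + R) := by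
        linarith [sq_nonneg (1 / 2 * g x + (f x + R))]
      have e8 := add_sq_le (a := f x) (b := R)
      linarith)
  rw [hprod.integral_eq_sub, intervalIntegral.integral_sub i1 i2,
    intervalIntegral.integral_add ig' (ig.const_mul _),
    intervalIntegral.integral_add (hf2.const_mul _) (iG.const_mul _),
    intervalIntegral.integral_const_mul, intervalIntegral.integral_const_mul,
    intervalIntegral.integral_const_mul] at hmono
  have hGi : ∫ x in s..b, G x ≤ 1152 * D ^ 2 := by
    have j1 : IntervalIntegrable (fun x => Real.exp (√2 * (x - b)) ^ 2) volume s b :=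
      (by fun_prop : Continuous fun x => Real.exp (√2 * (x - b)) ^ 2).intervalIntegrable _ _
    have j2 : IntervalIntegrable (fun x => Real.exp (-√2 * (x - s)) ^ 2) volume s b :=
      (by fun_prop : Continuous fun x => Real.exp (-√2 * (x - s)) ^ 2).intervalIntegrable _ _
    have k1 := integral_exp_two_mul_le (c := √2) (l := b) (b := b) (by linarith) s
    have k2 : ∫ x in s..b, Real.exp (-√2 * (x - s)) ^ 2 ≤ 1 := by
      have := integral_exp_two_mul_le (c := √2) (l := -s) (b := -s) (by linarith) (-b)
      rw [sub_self, mul_zero, Real.exp_zero, one_pow, ← intervalIntegral.integral_comp_neg] at this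
      refine le_of_eq_of_le ?_ this
      congr 1
      funext x
      congr 2
      ring
    rw [sub_self, mul_zero, Real.exp_zero, one_pow] at k1
    rw [hG, intervalIntegral.integral_const_mul, intervalIntegral.integral_add j1 j2]
    nlinarith [sq_nonneg D]
  -- At each end `U` equals the near kink exactly, so `g` there is only the tail of the far kink, at
  -- most `D`.
  have hab : a s ≤ D := (hae s).trans_eq (by rw [hD]; congr 1; ring)
  have hcb : c b ≤ D := (hce b).trans_eq (by rw [hD]; congr 1; ring)
  have small : ∀ y, 0 < y → y ≤ 1 / 5 → y ≤ D →
      0 ≤ √2 * y * (1 - y ^ 2) ∧ √2 * y * (1 - y ^ 2) ≤ 2 * D := by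
    intro y y0 y1 y2
    have h1 : 0 ≤ 1 - y ^ 2 := by nlinarith
    have h2 : 0 ≤ √2 * y := by positivity
    refine ⟨mul_nonneg h2 h1, ?_⟩
    have : √2 * y * (1 - y ^ 2) ≤ √2 * y := mul_le_of_le_one_right h2 (by nlinarith)
    nlinarith
  obtain ⟨sa1, sa2⟩ := small (a s) (ha0 s) (ha s (left_mem_Icc.2 hsb)) hab
  obtain ⟨sc1, sc2⟩ := small (c b) (hc0 b) (hc b (right_mem_Icc.2 hsb)) hcb
  have hgb : g b = c b := by simp only [hgdef]; rw [hUb]; ring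
  have hgs : g s = -a s := by simp only [hgdef]; rw [hUs]; ring
  have hK0 : 0 ≤ K * Φ + 2 * D := by positivity
  have q1 : g' b ≤ K * Φ + 2 * D := by
    have := (abs_le.1 hb).2
    simp only [hg'def]; linarith
  have q2 : g' s ≤ K * Φ + 2 * D := by
    have := (abs_le.1 hs).2
    simp only [hg'def]; linarith
  have r1 : c b * g' b ≤ D * (K * Φ + 2 * D) :=
    (mul_le_mul_of_nonneg_left q1 (hc0 b).le).trans (mul_le_mul_of_nonneg_right hcb hK0)
  have r2 : a s * g' s ≤ D * (K * Φ + 2 * D) :=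
    (mul_le_mul_of_nonneg_left q2 (ha0 s).le).trans (mul_le_mul_of_nonneg_right hab hK0)
  have hg'0 : 0 ≤ ∫ x in s..b, g' x ^ 2 :=
    intervalIntegral.integral_nonneg hsb fun x _ => sq_nonneg _
  have e9 : g b * (V b - √2 * a b * (1 - a b ^ 2) - √2 * c b * (1 - c b ^ 2)) = c b * g' b := by
    rw [hgb]
  have e10 : g s * (V s - √2 * a s * (1 - a s ^ 2) - √2 * c s * (1 - c s ^ 2))
      = -(a s * g' s) := by
    rw [hgs, neg_mul]
  rw [e9, e10] at hmono
  linarith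

/-! ### Translated kinks and their membership in `L²`. -/

theorem IsACPrimitive.congr_ae {F f g : ℝ → ℝ} (h : IsACPrimitive F f) (hfg : f =ᵐ[volume] g) :
    IsACPrimitive F g where
  ac := h.ac
  ae_hasDerivAt := by
    filter_upwards [h.ae_hasDerivAt, hfg] with x h1 h2
    rwa [← h2]

theorem hasDerivAt_kinkZeroOne_add (y x : ℝ) :
    HasDerivAt (fun x => kinkZeroOne (x + y))
      (√2 * kinkZeroOne (x + y) * (1 - kinkZeroOne (x + y) ^ 2)) x := by
  simpa using (hasDerivAt_kinkZeroOne (x + y)).comp_add_const x y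

theorem hasDerivAt_kinkZeroOne_neg_add (y x : ℝ) :
    HasDerivAt (fun x => kinkZeroOne (-(x + y)))
      (-(√2 * kinkZeroOne (-(x + y)) * (1 - kinkZeroOne (-(x + y)) ^ 2))) x := by
  have h := (hasDerivAt_kinkZeroOne (-(x + y))).comp x ((hasDerivAt_id x).add_const y).neg
  simpa [Function.comp_def] using h

theorem deriv_kinkZeroOne_bounds (x : ℝ) :
    0 ≤ √2 * kinkZeroOne x * (1 - kinkZeroOne x ^ 2) ∧
    √2 * kinkZeroOne x * (1 - kinkZeroOne x ^ 2) ≤ √2 * kinkZeroOne x ∧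
    √2 * kinkZeroOne x * (1 - kinkZeroOne x ^ 2) ≤ 2 * √2 * (1 - kinkZeroOne x) := by
  have h0 := kinkZeroOne_pos x
  have h1 := kinkZeroOne_lt_one x
  have h2 : 0 < √2 := by positivity
  have h3 : 0 ≤ 1 - kinkZeroOne x ^ 2 := by nlinarith
  refine ⟨by positivity, mul_le_of_le_one_right (by positivity) (by nlinarith), ?_⟩
  have : kinkZeroOne x * (1 - kinkZeroOne x ^ 2) ≤ 2 * (1 - kinkZeroOne x) := by
    have : kinkZeroOne x * (1 + kinkZeroOne x) ≤ 2 := by nlinarith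
    nlinarith [mul_le_mul_of_nonneg_left this (by linarith : 0 ≤ 1 - kinkZeroOne x)]
  nlinarith

theorem one_lt_sqrt_two : 1 < √2 := by
  rw [Real.lt_sqrt (by norm_num)]; norm_num

theorem sqrt_two_lt : √2 < 3 / 2 := by
  rw [Real.sqrt_lt' (by norm_num)]; norm_num

theorem memLp_deriv_kinkZeroOne :
    MemLp (fun x => √2 * kinkZeroOne x * (1 - kinkZeroOne x ^ 2)) 2 := by
  have hk := continuous_kinkZeroOne
  refine memLp_two_of_exp_decay (D := 3) (c := √2) (by fun_prop)
    (by linarith [one_lt_sqrt_two]) fun x => ?_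
  obtain ⟨h0, h1, h2⟩ := deriv_kinkZeroOne_bounds x
  rw [abs_of_nonneg h0]
  have h3 := sqrt_two_lt
  have h4 := one_lt_sqrt_two
  rcases le_total 0 x with hx | hx
  · rw [abs_of_nonneg hx]
    have h5 := one_sub_kinkZeroOne_le_exp x
    have h6 := kinkZeroOne_lt_one x
    nlinarith
  · rw [abs_of_nonpos hx, mul_neg, neg_neg]
    have h5 := kinkZeroOne_le_exp x
    have h6 := kinkZeroOne_pos x
    nlinarith

theorem memLp_comp_add_const {f : ℝ → ℝ} (hf : MemLp f 2) (y : ℝ) :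
    MemLp (fun x => f (x + y)) 2 :=
  hf.comp_measurePreserving (measurePreserving_add_right volume y)

theorem memLp_comp_neg {f : ℝ → ℝ} (hf : MemLp f 2) : MemLp (fun x => f (-x)) 2 :=
  hf.comp_measurePreserving (Measure.measurePreserving_neg volume)

/-- A kink is not square integrable, but two translates have the same limits at both ends and
approach them exponentially. This allows the shifts to be changed without leaving `H¹`. -/
theorem memLp_kinkZeroOne_sub (y y' : ℝ) :
    MemLp (fun x => kinkZeroOne (x + y) - kinkZeroOne (x + y')) 2 := by
  have hk := continuous_kinkZeroOne
  refine memLp_two_of_exp_decay (D := Real.exp (√2 * |y|) + Real.exp (√2 * |y'|)) (c := √2)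
    (by fun_prop) (by linarith [one_lt_sqrt_two]) fun x => ?_
  have h4 : 0 < √2 := by positivity
  have key : ∀ z z' : ℝ, z ≤ |y| - |x| → z' ≤ |y'| - |x| →
      Real.exp (√2 * z) + Real.exp (√2 * z')
        ≤ (Real.exp (√2 * |y|) + Real.exp (√2 * |y'|)) * Real.exp (-(√2 * |x|)) := by
    intro z z' h h'
    rw [add_mul, ← Real.exp_add, ← Real.exp_add]
    refine add_le_add (Real.exp_le_exp.2 ?_) (Real.exp_le_exp.2 ?_) <;> nlinarith
  have m1 := le_abs_self y
  have m2 := neg_abs_le y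
  have m3 := le_abs_self y'
  have m4 := neg_abs_le y'
  rcases le_total 0 x with hx | hx
  · refine le_trans ?_ (key (-(x + y)) (-(x + y')) ?_ ?_)
    · have h1 := one_sub_kinkZeroOne_le_exp (x + y)
      have h2 := one_sub_kinkZeroOne_le_exp (x + y')
      have h3 := kinkZeroOne_lt_one (x + y)
      have h4 := kinkZeroOne_lt_one (x + y')
      rw [mul_neg, mul_neg, abs_le]
      constructor <;> linarith
    · rw [abs_of_nonneg hx]; linarith
    · rw [abs_of_nonneg hx]; linarith
  · refine le_trans ?_ (key (x + y) (x + y') ?_ ?_)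
    · have h1 := kinkZeroOne_le_exp (x + y)
      have h2 := kinkZeroOne_le_exp (x + y')
      have h3 := kinkZeroOne_pos (x + y)
      have h4 := kinkZeroOne_pos (x + y')
      rw [abs_le]
      constructor <;> linarith
    · rw [abs_of_nonpos hx]; linarith
    · rw [abs_of_nonpos hx]; linarith

theorem exp_neg_ten_le : Real.exp (-10) ≤ 1 / 10000 := by
  rw [Real.exp_neg, ← one_div]
  refine one_div_le_one_div_of_le (by norm_num) ?_
  have h : (2.7 : ℝ) ≤ Real.exp 1 := by linarith [Real.exp_one_gt_d9]
  calc (10000 : ℝ) ≤ 2.7 ^ 10 := by norm_num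
    _ ≤ Real.exp 1 ^ 10 := pow_le_pow_left₀ (by norm_num) h 10
    _ = Real.exp 10 := by rw [← Real.exp_nat_mul]; norm_num

theorem seven_tenths_le_kinkZeroOne_zero : 7 / 10 ≤ kinkZeroOne 0 := by
  have h := kinkZeroOne_sq_mul 0
  rw [mul_zero, Real.exp_zero] at h
  nlinarith [kinkZeroOne_pos 0]

/-! ### Choosing the shifts by matching values. -/

/-- `H¹`-closeness to the kink sum implies uniform closeness; `-kinkZeroOne (-x)` is
`kinkNegOneZero x`. -/
theorem abs_sub_kink_sum_le {U V : ℝ → ℝ} (hU : IsACPrimitive U V) {x₁ x₂ : ℝ}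
    (hg : MemLp (fun x => U x - kinkZeroOne (x + x₁) + kinkZeroOne (-(x + x₂))) 2)
    (hg' : MemLp (fun x => V x
      - √2 * kinkZeroOne (x + x₁) * (1 - kinkZeroOne (x + x₁) ^ 2)
      - √2 * kinkZeroOne (-(x + x₂)) * (1 - kinkZeroOne (-(x + x₂)) ^ 2)) 2)
    (hsmall : (∫ x, (U x - kinkZeroOne (x + x₁) + kinkZeroOne (-(x + x₂))) ^ 2)
      + ∫ x, (V x - √2 * kinkZeroOne (x + x₁) * (1 - kinkZeroOne (x + x₁) ^ 2)
        - √2 * kinkZeroOne (-(x + x₂)) * (1 - kinkZeroOne (-(x + x₂)) ^ 2)) ^ 2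
      ≤ (1 / 10000) ^ 2) (x : ℝ) :
    |U x - kinkZeroOne (x + x₁) + kinkZeroOne (-(x + x₂))| ≤ 1 / 10000 := by
  have hk := continuous_kinkZeroOne
  have gP : IsACPrimitive (fun x => U x - kinkZeroOne (x + x₁) + kinkZeroOne (-(x + x₂)))
      (fun x => V x - √2 * kinkZeroOne (x + x₁) * (1 - kinkZeroOne (x + x₁) ^ 2)
        - √2 * kinkZeroOne (-(x + x₂)) * (1 - kinkZeroOne (-(x + x₂)) ^ 2)) :=
    ((hU.sub (.of_hasDerivAt (hasDerivAt_kinkZeroOne_add x₁) (by fun_prop))).add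
      (.of_hasDerivAt (hasDerivAt_kinkZeroOne_neg_add x₂) (by fun_prop))).congr fun x => by ring
  exact abs_le_of_sq_le_sq ((gP.sq_le_integral hg hg' x).trans hsmall) (by norm_num)

/-- Right of the midpoint, a function near the kink sum is close in `H¹` to a single kink. -/
theorem exists_right_kink {U V W : ℝ → ℝ} (hU : IsACPrimitive U V) (hV : IsACPrimitive V W)
    (hf : MemLp (fun x => W x - (2 * U x - 8 * U x ^ 3 + 6 * U x ^ 5)) 2) {x₁ x₂ : ℝ}
    (hx : 20 < x₂ - x₁)
    (hg : MemLp (fun x => U x - kinkZeroOne (x + x₁) + kinkZeroOne (-(x + x₂))) 2)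
    (hg' : MemLp (fun x => V x
      - √2 * kinkZeroOne (x + x₁) * (1 - kinkZeroOne (x + x₁) ^ 2)
      - √2 * kinkZeroOne (-(x + x₂)) * (1 - kinkZeroOne (-(x + x₂)) ^ 2)) 2)
    (hclose : ∀ x, |U x - kinkZeroOne (x + x₁) + kinkZeroOne (-(x + x₂))| ≤ 1 / 10000) :
    ∃ b y : ℝ, -(x₁ + x₂) / 2 ≤ b ∧ U b = 1 / 5 ∧ kinkZeroOne (b + y) = 1 / 5 ∧
      IntegrableOn (fun x => (U x - kinkZeroOne (x + y)) ^ 2) (Ioi b) ∧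
      IntegrableOn (fun x =>
        (V x - √2 * kinkZeroOne (x + y) * (1 - kinkZeroOne (x + y) ^ 2)) ^ 2) (Ioi b) ∧
      ∀ Φ, 0 < Φ → ∫ x, (W x - (2 * U x - 8 * U x ^ 3 + 6 * U x ^ 5)) ^ 2 ≤ Φ ^ 2 →
        |V b - √2 * kinkZeroOne (b + y) * (1 - kinkZeroOne (b + y) ^ 2)| ≤ 4000 * Φ ∧
        ∫ x in Ioi b, (U x - kinkZeroOne (x + y)) ^ 2 ≤ 10 ^ 7 * Φ ^ 2 ∧
        ∫ x in Ioi b, (V x - √2 * kinkZeroOne (x + y) * (1 - kinkZeroOne (x + y) ^ 2)) ^ 2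
          ≤ 10 ^ 7 * Φ ^ 2 := by
  have hk := continuous_kinkZeroOne
  have c1 := one_lt_sqrt_two
  have hUc := hU.continuous
  set m := -(x₁ + x₂) / 2 with hm
  -- The midpoint is at distance more than `10` from `-x₂`, because the separation exceeds `20`.
  have htail : ∀ x, m ≤ x → kinkZeroOne (-(x + x₂)) ≤ 1 / 10000 := by
    intro x hx'
    refine (kinkZeroOne_le_exp _).trans (le_trans (Real.exp_le_exp.2 ?_) exp_neg_ten_le)
    have : 10 ≤ x + x₂ := by linarith
    nlinarith
  have hUm : U m ≤ 1 / 5 := by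
    have h1 := (abs_le.1 (hclose m)).2
    -- By symmetry the two kinks cancel exactly at the midpoint.
    rw [show m + x₁ = -(m + x₂) by rw [hm]; ring] at h1
    linarith
  have hU1 : 1 / 5 ≤ U (-x₁) := by
    have h1 := (abs_le.1 (hclose (-x₁))).1
    have h2 := htail (-x₁) (by rw [hm]; linarith)
    have h3 := seven_tenths_le_kinkZeroOne_zero
    rw [neg_add_cancel] at h1
    linarith
  obtain ⟨b, ⟨hmb, -⟩, hb⟩ := intermediate_value_Icc (show m ≤ -x₁ by rw [hm]; linarith)
    hUc.continuousOn (show (1 / 5 : ℝ) ∈ Icc (U m) (U (-x₁)) from ⟨hUm, hU1⟩)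
  obtain ⟨X, hX⟩ := exists_kinkZeroOne_eq_fifth
  have hbX : b + (X - b) = X := by ring
  have hnear : ∀ x, b ≤ x → |U x - kinkZeroOne (x + x₁)| ≤ 1 / 5000 := by
    intro x hx'
    have h1 := abs_le.1 (hclose x)
    have h2 := htail x (hmb.trans hx')
    have h3 := kinkZeroOne_pos (-(x + x₂))
    rw [abs_le]
    constructor <;> linarith [h1.1, h1.2]
  have hmatch : ∀ x, b ≤ x → |U x - kinkZeroOne (x + (X - b))| ≤ 1 / 40 := by
    intro x hx'
    have h1 := hnear b le_rfl
    rw [hb, abs_sub_comm] at h1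
    have h2 := abs_kinkZeroOne_sub_le hX (h1.trans (by norm_num)) (x - b)
    rw [show b + x₁ + (x - b) = x + x₁ by ring, show X + (x - b) = x + (X - b) by ring] at h2
    have h3 := abs_le.1 h2
    have h4 := abs_le.1 (hnear x hx')
    rw [abs_le]
    constructor <;> linarith [h3.1, h3.2, h4.1, h4.2]
  have hdec : MemLp (fun x => kinkZeroOne (-(x + x₂))) 2 (volume.restrict (Ioi b)) := by
    rw [memLp_two_iff_integrable_sq (by fun_prop : Continuous _).aestronglyMeasurable]
    refine (integrableOn_Ioi_sq_of_exp_decay (D := Real.exp (-(√2 * (b + x₂)))) (c := √2)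
      (by fun_prop) (by linarith) fun x _ => ?_).1
    rw [abs_of_pos (kinkZeroOne_pos _), ← Real.exp_add]
    refine (kinkZeroOne_le_exp _).trans_eq ?_
    congr 1; ring
  have hd : MemLp (fun x => U x - kinkZeroOne (x + (X - b))) 2 (volume.restrict (Ioi b)) := by
    have := (((hg.add (memLp_kinkZeroOne_sub x₁ (X - b))).restrict (Ioi b)).sub hdec)
    refine this.congr_norm (by fun_prop : Continuous _).aestronglyMeasurable
      (ae_of_all _ fun x => ?_)
    simp only [Pi.add_apply, Pi.sub_apply]
    congr 1; ring
  have hd' : MemLp (fun x => V x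
      - √2 * kinkZeroOne (x + (X - b)) * (1 - kinkZeroOne (x + (X - b)) ^ 2)) 2
      (volume.restrict (Ioi b)) := by
    have h1 := memLp_comp_add_const memLp_deriv_kinkZeroOne x₁
    have h2 := memLp_comp_add_const (memLp_comp_neg memLp_deriv_kinkZeroOne) x₂
    have h3 := memLp_comp_add_const memLp_deriv_kinkZeroOne (X - b)
    refine ((((hg'.add h1).add h2).sub h3).restrict (Ioi b)).congr_norm
      (by have := hV.continuous; fun_prop : Continuous _).aestronglyMeasurable
      (ae_of_all _ fun x => ?_)
    simp only [Pi.add_apply, Pi.sub_apply]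
    congr 1; ring
  have est := half_line_estimate hU hV (hasDerivAt_kinkZeroOne_add (X - b))
    (fun x => kinkZeroOne_pos _) (fun x => kinkZeroOne_lt_one _) (by rw [hbX, hX]) hb
    (fun x hx' => by
      rw [← hX]
      exact monotone_kinkZeroOne (by linarith)) hmatch (hf.restrict _) hd hd'
  -- The shift is fixed before `Φ`, so it stays the same when `Φ` later decreases to the defect
  -- norm.
  refine ⟨b, X - b, hmb, hb, by rw [hbX, hX], hd.integrable_sq, hd'.integrable_sq,
    fun Φ hΦ hfΦ => ?_⟩
  have hle : ∫ x in Ioi b, (W x - (2 * U x - 8 * U x ^ 3 + 6 * U x ^ 5)) ^ 2 ≤ Φ ^ 2 :=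
    (setIntegral_le_integral hf.integrable_sq (ae_of_all _ fun x => sq_nonneg _)).trans hfΦ
  refine ⟨abs_le_of_sq_le_sq ?_ (by positivity), by linarith [est.2.1], by linarith [est.2.2]⟩
  -- The constant `4000` satisfies `10 ^ 7 ≤ 4000 ^ 2`.
  nlinarith [est.1]

/-! ### Gluing the three regions. -/

/-- A perturbation of size `D` with exponential decay changes half-line errors by `O(D)`. -/
theorem tail_estimate {d d' c : ℝ → ℝ} {b D M : ℝ}
    (hd : IntegrableOn (fun x => d x ^ 2) (Ioi b)) (hd' : IntegrableOn (fun x => d' x ^ 2) (Ioi b))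
    (hc : Continuous c) (hc0 : ∀ x, 0 < c x) (hc1 : ∀ x, c x < 1)
    (hcD : ∀ x, c x ≤ D * Real.exp (-(√2 * (x - b))))
    (hdM : ∫ x in Ioi b, d x ^ 2 ≤ M) (hd'M : ∫ x in Ioi b, d' x ^ 2 ≤ M) :
    ∫ x in Ioi b, (d x + c x) ^ 2 ≤ 2 * M + 2 * D ^ 2 ∧
    ∫ x in Ioi b, (d' x - √2 * c x * (1 - c x ^ 2)) ^ 2 ≤ 2 * M + 4 * D ^ 2 := by
  have c2 : √2 ^ 2 = 2 := Real.sq_sqrt (by norm_num)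
  obtain ⟨hci, hcI⟩ := integrableOn_Ioi_sq_of_exp_decay hc (c := √2) (b := b) (D := D)
    (by linarith [one_lt_sqrt_two]) fun x _ => by
      rw [abs_of_pos (hc0 x)]
      exact hcD x
  constructor
  · have := integral_mono_of_nonneg (μ := volume.restrict (Ioi b))
      (f := fun x => (d x + c x) ^ 2) (g := fun x => 2 * d x ^ 2 + 2 * c x ^ 2)
      (ae_of_all _ fun x => sq_nonneg _) ((hd.const_mul 2).add (hci.const_mul 2))
      (ae_of_all _ fun x => by linarith [add_sq_le (a := d x) (b := c x)])
    rw [integral_add (hd.const_mul 2) (hci.const_mul 2), integral_const_mul,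
      integral_const_mul] at this
    linarith
  · have := integral_mono_of_nonneg (μ := volume.restrict (Ioi b))
      (f := fun x => (d' x - √2 * c x * (1 - c x ^ 2)) ^ 2)
      (g := fun x => 2 * d' x ^ 2 + 4 * c x ^ 2)
      (ae_of_all _ fun x => sq_nonneg _) ((hd'.const_mul 2).add (hci.const_mul 4))
      (ae_of_all _ fun x => by
        have h1 := add_sq_le (a := d' x) (b := -(√2 * c x * (1 - c x ^ 2)))
        have h2 : (√2 * c x * (1 - c x ^ 2)) ^ 2 ≤ 2 * c x ^ 2 := by
          have h3 : (1 - c x ^ 2) ^ 2 ≤ 1 := by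
            have := hc0 x
            have := hc1 x
            exact pow_le_one₀ (by nlinarith) (by nlinarith)
          rw [mul_pow, mul_pow, c2]
          exact mul_le_of_le_one_right (by positivity) h3
        rw [← sub_eq_add_neg, neg_sq] at h1
        linarith)
    rw [integral_add (hd'.const_mul 2) (hci.const_mul 4), integral_const_mul,
      integral_const_mul] at this
    linarith

/-- Lets a kink with value `1 / 5` at `b` be bounded by `e^{√2 (x - b)}` with constant one. -/
theorem exp_sqrt_two_le_one_of_eq_fifth {x : ℝ} (hx : kinkZeroOne x = 1 / 5) :
    Real.exp (√2 * x) ≤ 1 := by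
  nlinarith [exp_sq_of_kinkZeroOne_eq_fifth hx, Real.exp_pos (√2 * x)]

/-- The stability estimate for functions with absolutely continuous derivative. -/
theorem kink_sum_stability {U V W : ℝ → ℝ} (hU : IsACPrimitive U V) (hV : IsACPrimitive V W)
    (hf : MemLp (fun x => W x - (2 * U x - 8 * U x ^ 3 + 6 * U x ^ 5)) 2) {x₁ x₂ : ℝ}
    (hx : 20 < x₂ - x₁)
    (hg : MemLp (fun x => U x - kinkZeroOne (x + x₁) + kinkZeroOne (-(x + x₂))) 2)
    (hg' : MemLp (fun x => V x
      - √2 * kinkZeroOne (x + x₁) * (1 - kinkZeroOne (x + x₁) ^ 2)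
      - √2 * kinkZeroOne (-(x + x₂)) * (1 - kinkZeroOne (-(x + x₂)) ^ 2)) 2)
    (hsmall : (∫ x, (U x - kinkZeroOne (x + x₁) + kinkZeroOne (-(x + x₂))) ^ 2)
      + ∫ x, (V x - √2 * kinkZeroOne (x + x₁) * (1 - kinkZeroOne (x + x₁) ^ 2)
        - √2 * kinkZeroOne (-(x + x₂)) * (1 - kinkZeroOne (-(x + x₂)) ^ 2)) ^ 2
      ≤ (1 / 10000) ^ 2) :
    ∃ y₁ y₂ : ℝ,
      MemLp (fun x => U x - kinkZeroOne (x + y₁) + kinkZeroOne (-(x + y₂))) 2 ∧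
      MemLp (fun x => V x
        - √2 * kinkZeroOne (x + y₁) * (1 - kinkZeroOne (x + y₁) ^ 2)
        - √2 * kinkZeroOne (-(x + y₂)) * (1 - kinkZeroOne (-(x + y₂)) ^ 2)) 2 ∧
      ∀ Φ, 0 < Φ → ∫ x, (W x - (2 * U x - 8 * U x ^ 3 + 6 * U x ^ 5)) ^ 2 ≤ Φ ^ 2 →
        (∫ x, (U x - kinkZeroOne (x + y₁) + kinkZeroOne (-(x + y₂))) ^ 2)
          + ∫ x, (V x - √2 * kinkZeroOne (x + y₁) * (1 - kinkZeroOne (x + y₁) ^ 2)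
            - √2 * kinkZeroOne (-(x + y₂)) * (1 - kinkZeroOne (-(x + y₂)) ^ 2)) ^ 2
          ≤ 10 ^ 13 * Φ ^ 2 ∧
        Real.exp (-(√2 * (y₂ - y₁))) ≤ 24000 * Φ := by
  have hk := continuous_kinkZeroOne
  have hUc := hU.continuous
  have hVc := hV.continuous
  have c1 := one_lt_sqrt_two
  have hclose := abs_sub_kink_sum_le hU hg hg' hsmall
  obtain ⟨b, y₁, hmb, hUb, hb, hdi, hdi', hR⟩ := exists_right_kink hU hV hf hx hg hg' hclose
  -- the reflected solution `x ↦ -U (-x)`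
  have hrU : IsACPrimitive (fun x => -U (-x)) (fun x => V (-x)) := by
    simpa using hU.comp_neg.const_mul (-1)
  have hrf : (fun x => -W (-x) - (2 * -U (-x) - 8 * (-U (-x)) ^ 3 + 6 * (-U (-x)) ^ 5))
      = fun x => -(W (-x) - (2 * U (-x) - 8 * U (-x) ^ 3 + 6 * U (-x) ^ 5)) := by
    funext x; ring
  have hrc : ∀ x, -U (-x) - kinkZeroOne (x + -x₂) + kinkZeroOne (-(x + -x₁))
      = -(U (-x) - kinkZeroOne (-x + x₁) + kinkZeroOne (-(-x + x₂))) := fun x => by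
    rw [show -(-x + x₂) = x + -x₂ by ring, show -(x + -x₁) = -x + x₁ by ring]; ring
  obtain ⟨s', y', hms, hUs', hs', hri, hri', hL⟩ := exists_right_kink (x₁ := -x₂) (x₂ := -x₁) hrU
    hV.comp_neg (by rw [hrf]; exact (memLp_comp_neg hf).neg) (by linarith)
    (by simp only [hrc]; exact (memLp_comp_neg hg).neg)
    (by
      refine (memLp_comp_neg hg').congr_norm
        (by fun_prop : Continuous _).aestronglyMeasurable (ae_of_all _ fun x => ?_)
      rw [show -(-x + x₂) = x + -x₂ by ring, show -(x + -x₁) = -x + x₁ by ring]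
      congr 1; ring)
    (fun x => by rw [hrc, abs_neg]; exact hclose (-x))
  have hs2 : kinkZeroOne (-(-s' + -y')) = 1 / 5 := by rw [← hs']; congr 1; ring
  have hUs : U (-s') = -(1 / 5) := by linarith
  have hsb : -s' ≤ b := by linarith
  have hXb := exp_sqrt_two_le_one_of_eq_fifth hb
  have hXs := exp_sqrt_two_le_one_of_eq_fifth hs'
  have hae : ∀ x, kinkZeroOne (x + y₁) ≤ Real.exp (√2 * (x - b)) := fun x => by
    refine (kinkZeroOne_le_exp _).trans ?_
    rw [show √2 * (x + y₁) = √2 * (x - b) + √2 * (b + y₁) by ring, Real.exp_add]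
    exact mul_le_of_le_one_right (Real.exp_pos _).le hXb
  have hce : ∀ x, kinkZeroOne (-(x + -y')) ≤ Real.exp (-√2 * (x - -s')) := fun x => by
    refine (kinkZeroOne_le_exp _).trans ?_
    rw [show √2 * -(x + -y') = -√2 * (x - -s') + √2 * (s' + y') by ring, Real.exp_add]
    exact mul_le_of_le_one_right (Real.exp_pos _).le hXs
  have hgy : MemLp (fun x => U x - kinkZeroOne (x + y₁) + kinkZeroOne (-(x + -y'))) 2 := by
    have h1 := memLp_kinkZeroOne_sub x₁ y₁
    have h2 := memLp_comp_neg (memLp_kinkZeroOne_sub y' (-x₂))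
    refine ((hg.add h1).add h2).congr_norm (by fun_prop : Continuous _).aestronglyMeasurable
      (ae_of_all _ fun x => ?_)
    simp only [Pi.add_apply]
    rw [show -(x + -y') = -x + y' by ring, show -(x + x₂) = -x + -x₂ by ring]
    congr 1; ring
  have hg'y : MemLp (fun x => V x
        - √2 * kinkZeroOne (x + y₁) * (1 - kinkZeroOne (x + y₁) ^ 2)
        - √2 * kinkZeroOne (-(x + -y')) * (1 - kinkZeroOne (-(x + -y')) ^ 2)) 2 := by
    have h1 := fun y => memLp_comp_add_const memLp_deriv_kinkZeroOne y
    have h2 := fun y => memLp_comp_add_const (memLp_comp_neg memLp_deriv_kinkZeroOne) y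
    refine ((((hg'.add (h1 x₁)).add (h2 x₂)).sub (h1 y₁)).sub (h2 (-y'))).congr_norm
      (by fun_prop : Continuous _).aestronglyMeasurable (ae_of_all _ fun x => ?_)
    simp only [Pi.add_apply, Pi.sub_apply]
    congr 1; ring
  refine ⟨y₁, -y', hgy, hg'y, fun Φ hΦ hfΦ => ?_⟩
  obtain ⟨Rb, Rd, Rd'⟩ := hR Φ hΦ hfΦ
  obtain ⟨Lb, Ld, Ld'⟩ := hL Φ hΦ (by
    have h1 := integral_neg_eq_self
      (fun x => (W x - (2 * U x - 8 * U x ^ 3 + 6 * U x ^ 5)) ^ 2) volume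
    rw [← h1] at hfΦ
    refine le_of_eq_of_le ?_ hfΦ
    congr 1
    funext x
    ring)
  set D := Real.exp (-(√2 * (b - -s'))) with hDdef
  have hDΦ : D ≤ 6 * 4000 * Φ := by
    refine exp_neg_length_le hsb hU hV hf.integrable_sq hΦ hfΦ (by norm_num) ?_ ?_
    · rwa [hUb, ← hb]
    -- At the left point `V` is within `4000 * Φ` of `w (1/5)` while `U = -1/5`, so `p` is within
    -- that distance of `2 * w (1/5) = 48√2 / 125`, which exceeds `1 / 2`.
    · rw [hs'] at Lb
      rw [hUs]
      have h1 := (abs_le.1 Lb).1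
      have h2 : 7 / 5 ≤ √2 := by
        rw [Real.le_sqrt' (by norm_num)]; norm_num
      linarith
  have hmid := middle_estimate (a := fun x => kinkZeroOne (x + y₁))
    (c := fun x => kinkZeroOne (-(x + -y'))) hsb hU hV hf.integrable_sq hΦ hfΦ
    (hasDerivAt_kinkZeroOne_add y₁) (hasDerivAt_kinkZeroOne_neg_add (-y'))
    (fun x => kinkZeroOne_pos _) (fun x => kinkZeroOne_pos _)
    (fun x hx' => by
      rw [← hb]; exact monotone_kinkZeroOne (by linarith [hx'.2]))
    (fun x hx' => by
      rw [← hs']; exact monotone_kinkZeroOne (by linarith [hx'.1]))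
    hae hce
    (fun x hx' => by
      -- The original kink sum is increasing and `1 / 10000`-close to `U`, so between the two points
      -- `U` stays within `2 / 10000` of `[-1/5, 1/5]`.
      have m1 : kinkZeroOne (x + x₁) ≤ kinkZeroOne (b + x₁) :=
        monotone_kinkZeroOne (by linarith [hx'.2])
      have m2 : kinkZeroOne (-(b + x₂)) ≤ kinkZeroOne (-(x + x₂)) :=
        monotone_kinkZeroOne (by linarith [hx'.2])
      have m3 : kinkZeroOne (-s' + x₁) ≤ kinkZeroOne (x + x₁) :=
        monotone_kinkZeroOne (by linarith [hx'.1])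
      have m4 : kinkZeroOne (-(x + x₂)) ≤ kinkZeroOne (-(-s' + x₂)) :=
        monotone_kinkZeroOne (by linarith [hx'.1])
      have n1 := abs_le.1 (hclose x)
      have n2 := abs_le.1 (hclose b)
      have n3 := abs_le.1 (hclose (-s'))
      rw [abs_le]
      constructor <;> linarith [n1.1, n1.2, n2.1, n2.2, n3.1, n3.2])
    (by rw [hUb]; exact hb.symm) (by rw [hUs, hs2]) (by norm_num)
    Rb (by
      rw [hs2]
      rwa [hs'] at Lb)
  beta_reduce at hmid
  rw [← hDdef] at hmid
  obtain ⟨tR, tR'⟩ := tail_estimate (c := fun x => kinkZeroOne (-(x + -y'))) (D := D) hdi hdi'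
    (by fun_prop) (fun x => kinkZeroOne_pos _) (fun x => kinkZeroOne_lt_one _)
    (fun x => (hce x).trans_eq (by rw [hDdef, ← Real.exp_add]; congr 1; ring)) Rd Rd'
  obtain ⟨tL, tL'⟩ := tail_estimate (c := fun x => kinkZeroOne (-x + y₁)) (D := D) hri hri'
    (by fun_prop) (fun x => kinkZeroOne_pos _) (fun x => kinkZeroOne_lt_one _)
    (fun x => (hae (-x)).trans_eq (by rw [hDdef, ← Real.exp_add]; congr 1; ring)) Ld Ld'
  -- The left half-line is written in reflected coordinates, where its estimate was obtained.
  have split : ∀ k : ℝ → ℝ, Integrable k →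
      ∫ x, k x = (∫ x in Ioi s', k (-x)) + (∫ x in (-s')..b, k x) + ∫ x in Ioi b, k x := by
    intro k hk
    rw [integral_comp_neg_Ioi, add_assoc,
      intervalIntegral.integral_interval_add_Ioi hk.integrableOn hk.integrableOn,
      intervalIntegral.integral_Iic_add_Ioi hk.integrableOn hk.integrableOn]
  have gsq := hgy.integrable_sq
  have g'sq := hg'y.integrable_sq
  rw [split _ gsq, split _ g'sq]
  have eL : ∀ x, (U (-x) - kinkZeroOne (-x + y₁) + kinkZeroOne (-(-x + -y'))) ^ 2
      = (-U (-x) - kinkZeroOne (x + y') + kinkZeroOne (-x + y₁)) ^ 2 := fun x => by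
    rw [show -(-x + -y') = x + y' by ring]; ring
  have eL' : ∀ x, (V (-x) - √2 * kinkZeroOne (-x + y₁) * (1 - kinkZeroOne (-x + y₁) ^ 2)
      - √2 * kinkZeroOne (-(-x + -y')) * (1 - kinkZeroOne (-(-x + -y')) ^ 2)) ^ 2
      = (V (-x) - √2 * kinkZeroOne (x + y') * (1 - kinkZeroOne (x + y') ^ 2)
      - √2 * kinkZeroOne (-x + y₁) * (1 - kinkZeroOne (-x + y₁) ^ 2)) ^ 2 := fun x => by
    rw [show -(-x + -y') = x + y' by ring]; ring
  simp only [eL, eL']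
  have hD0 : 0 < D := Real.exp_pos _
  have hD2 : D ^ 2 ≤ 576000000 * Φ ^ 2 := by
    have := pow_le_pow_left₀ hD0.le hDΦ 2
    linarith
  have hDΦ2 : D * Φ ≤ 24000 * Φ ^ 2 := by
    have := mul_le_mul_of_nonneg_right hDΦ hΦ.le
    linarith
  refine ⟨by nlinarith, ?_⟩
  have : Real.exp (-(√2 * (-y' - y₁)))
      = D * (Real.exp (√2 * (b + y₁)) * Real.exp (√2 * (s' + y'))) := by
    rw [hDdef, ← Real.exp_add, ← Real.exp_add]
    congr 1; ring
  rw [this]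
  have h1 : Real.exp (√2 * (b + y₁)) * Real.exp (√2 * (s' + y')) ≤ 1 :=
    mul_le_one₀ hXb (Real.exp_pos _).le hXs
  have := mul_le_of_le_one_right hD0.le h1
  linarith

/-! ### From extended norms to integrals, and the conclusion. -/

theorem eLpNorm_two_sq_eq {f : ℝ → ℝ} (hf : MemLp f 2) :
    eLpNorm f 2 volume ^ 2 = ENNReal.ofReal (∫ x, f x ^ 2) := by
  rw [hf.eLpNorm_eq_integral_rpow_norm (by norm_num) (by norm_num),
    ← ENNReal.ofReal_pow (by positivity)]
  congr 1
  have h0 : 0 ≤ ∫ x, f x ^ 2 := integral_nonneg fun x => sq_nonneg _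
  simp only [ENNReal.toReal_ofNat, Real.rpow_two, Real.norm_eq_abs, sq_abs]
  rw [← Real.rpow_natCast, ← Real.rpow_mul h0]
  norm_num

theorem hOneNorm_le {f g : ℝ → ℝ} (h : HasWeakDeriv 1 f g) (hf : MemLp f 2) (hg : MemLp g 2)
    {r : ℝ} (hr : 0 ≤ r) (hle : (∫ x, f x ^ 2) + ∫ x, g x ^ 2 ≤ r ^ 2) :
    hOneNorm f ≤ ENNReal.ofReal r := by
  refine (iInf₂_le g h).trans ?_
  rw [eLpNorm_two_sq_eq hf, eLpNorm_two_sq_eq hg,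
    ← ENNReal.ofReal_add (integral_nonneg fun x => sq_nonneg _)
      (integral_nonneg fun x => sq_nonneg _)]
  refine (ENNReal.rpow_le_rpow (ENNReal.ofReal_le_ofReal hle) (by norm_num)).trans_eq ?_
  rw [ENNReal.ofReal_rpow_of_nonneg (by positivity) (by norm_num), ← Real.sqrt_eq_rpow,
    Real.sqrt_sq hr]

theorem exists_of_hOneNorm_lt {f : ℝ → ℝ} {r : ℝ} (hr : 0 < r)
    (h : hOneNorm f < ENNReal.ofReal r) :
    ∃ g, HasWeakDeriv 1 f g ∧ MemLp f 2 ∧ MemLp g 2 ∧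
      (∫ x, f x ^ 2) + ∫ x, g x ^ 2 ≤ r ^ 2 := by
  unfold hOneNorm at h
  simp only [iInf_lt_iff] at h
  obtain ⟨g, hg, hlt⟩ := h
  have h2 : eLpNorm f 2 volume ^ 2 + eLpNorm g 2 volume ^ 2 < ENNReal.ofReal (r ^ 2) := by
    have := ENNReal.rpow_lt_rpow hlt (z := 2) (by norm_num)
    rw [← ENNReal.rpow_mul] at this
    norm_num at this
    rwa [ENNReal.ofReal_pow hr.le]
  have hfin := h2.trans_le le_top
  rw [ENNReal.add_lt_top, ENNReal.pow_lt_top_iff, ENNReal.pow_lt_top_iff] at hfin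
  have hf : MemLp f 2 := ⟨hg.1.aestronglyMeasurable, by simpa using hfin.1⟩
  have hg2 : MemLp g 2 := ⟨hg.2.1.aestronglyMeasurable, by simpa using hfin.2⟩
  refine ⟨g, hg, hf, hg2, ?_⟩
  rw [eLpNorm_two_sq_eq hf, eLpNorm_two_sq_eq hg2,
    ← ENNReal.ofReal_add (integral_nonneg fun x => sq_nonneg _)
      (integral_nonneg fun x => sq_nonneg _)] at h2
  exact (ENNReal.ofReal_lt_ofReal_iff (by positivity)).1 h2 |>.le

/-- Uniqueness of the weak derivative up to null sets makes the infimum run over a single value. -/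
theorem stationaryDefectNorm_eq {u w : ℝ → ℝ} (h : HasWeakDeriv 2 u w) :
    stationaryDefectNorm u
      = eLpNorm (fun x => w x - 2 * u x + 8 * u x ^ 3 - 6 * u x ^ 5) 2 volume := by
  refine le_antisymm (iInf₂_le w h) (le_iInf₂ fun w' h' => le_of_eq (eLpNorm_congr_ae ?_))
  filter_upwards [h.ae_eq h'] with x hx
  rw [hx]

theorem theorem1p2 :
    ∃ a ε C : ℝ, 0 < a ∧ 0 < ε ∧ 0 < C ∧
      ∀ u : ℝ → ℝ, MemLp u ∞ volume →
        ∀ x₁ x₂ : ℝ, a < x₂ - x₁ →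
          hOneNorm (fun x => u x - kinkZeroOne (x + x₁) - kinkNegOneZero (x + x₂))
              < ENNReal.ofReal ε →
          ∃ y₁ y₂ : ℝ,
            hOneNorm (fun x => u x - kinkZeroOne (x + y₁) - kinkNegOneZero (x + y₂))
                + ENNReal.ofReal (Real.exp (-(√2 * (y₂ - y₁))))
              ≤ ENNReal.ofReal C * stationaryDefectNorm u := by
  refine ⟨20, 1 / 10000, 10 ^ 7, by norm_num, by norm_num, by norm_num, ?_⟩
  intro u _ x₁ x₂ hx hclose
  simp only [kinkNegOneZero_eq, sub_neg_eq_add] at hclose ⊢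
  rcases eq_or_ne (stationaryDefectNorm u) ⊤ with htop | htop
  -- An infinite defect makes the right-hand side infinite, so any shifts serve.
  · refine ⟨x₁, x₂, ?_⟩
    rw [htop, ENNReal.mul_top (by simp)]
    exact le_top
  have hlt := lt_top_iff_ne_top.2 htop
  unfold stationaryDefectNorm at hlt
  simp only [iInf_lt_iff] at hlt
  obtain ⟨w, hw, hwfin⟩ := hlt
  obtain ⟨g', hg', hgL, hg'L, hsmall⟩ := exists_of_hOneNorm_lt (by norm_num) hclose
  have hk := continuous_kinkZeroOne
  have hkP : ∀ y₁ y₂, IsACPrimitive (fun x => kinkZeroOne (x + y₁) - kinkZeroOne (-(x + y₂)))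
      (fun x => √2 * kinkZeroOne (x + y₁) * (1 - kinkZeroOne (x + y₁) ^ 2)
        + √2 * kinkZeroOne (-(x + y₂)) * (1 - kinkZeroOne (-(x + y₂)) ^ 2)) := fun y₁ y₂ =>
    (IsACPrimitive.sub (.of_hasDerivAt (hasDerivAt_kinkZeroOne_add y₁) (by fun_prop))
      (.of_hasDerivAt (hasDerivAt_kinkZeroOne_neg_add y₂) (by fun_prop))).congr fun x => by ring
  have hu1 := hg'.add ((hkP x₁ x₂).hasWeakDeriv (u := _) EventuallyEq.rfl)
  have hue : ∀ x, u x - kinkZeroOne (x + x₁) + kinkZeroOne (-(x + x₂))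
      + (kinkZeroOne (x + x₁) - kinkZeroOne (-(x + x₂))) = u x := fun x => by ring
  simp only [hue] at hu1
  obtain ⟨V, hvV, hV⟩ := (hu1.deriv_of_two hw).exists_isACPrimitive
  obtain ⟨U, huU, hU'⟩ := hu1.exists_isACPrimitive
  have hU := hU'.congr_ae hvV
  have hwf : MemLp (fun x => w x - 2 * u x + 8 * u x ^ 3 - 6 * u x ^ 5) 2 :=
    ⟨by
      have h1 := hw.1.aestronglyMeasurable
      have h2 := hw.2.1.aestronglyMeasurable
      fun_prop, hwfin⟩
  have hfe : (fun x => w x - 2 * u x + 8 * u x ^ 3 - 6 * u x ^ 5)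
      =ᵐ[volume] fun x => w x - (2 * U x - 8 * U x ^ 3 + 6 * U x ^ 5) := by
    filter_upwards [huU] with x hx'
    rw [hx']; ring
  have hge : ∀ y₁ y₂, (fun x => u x - kinkZeroOne (x + y₁) + kinkZeroOne (-(x + y₂)))
      =ᵐ[volume] fun x => U x - kinkZeroOne (x + y₁) + kinkZeroOne (-(x + y₂)) := fun y₁ y₂ => by
    filter_upwards [huU] with x hx'
    rw [hx']
  have hg'e : g' =ᵐ[volume] fun x => V x
      - √2 * kinkZeroOne (x + x₁) * (1 - kinkZeroOne (x + x₁) ^ 2)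
      - √2 * kinkZeroOne (-(x + x₂)) * (1 - kinkZeroOne (-(x + x₂)) ^ 2) := by
    filter_upwards [hvV] with x hx'
    rw [← hx']; ring
  have hf := hwf.ae_eq hfe
  obtain ⟨y₁, y₂, hy, hy', hest⟩ := kink_sum_stability hU hV hf hx (hgL.ae_eq (hge x₁ x₂))
    (hg'L.ae_eq hg'e) (by
      refine le_of_eq_of_le ?_ hsmall
      congr 1
      · refine integral_congr_ae ?_
        filter_upwards [hge x₁ x₂] with x hx'
        rw [hx']
      · refine integral_congr_ae ?_
        filter_upwards [hg'e] with x hx'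
        rw [hx'])
  refine ⟨y₁, y₂, ?_⟩
  rw [stationaryDefectNorm_eq hw, eLpNorm_congr_ae hfe]
  set N := eLpNorm (fun x => w x - (2 * U x - 8 * U x ^ 3 + 6 * U x ^ 5)) 2 volume with hN
  have hNfin : N ≠ ⊤ := hf.2.ne
  refine ENNReal.le_of_forall_pos_le_add fun δ hδ _ => ?_
  -- The added `δ / 10 ^ 7` keeps `Φ` positive even for zero defect, and is scaled so that `10 ^ 7 *
  -- Φ` exceeds `10 ^ 7` times the defect by exactly `δ`.
  set Φ : ℝ := N.toReal + δ / 10 ^ 7 with hΦ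
  have hδ' : (0 : ℝ) < δ := hδ
  have hΦ0 : 0 < Φ := by positivity
  have hint : ∫ x, (w x - (2 * U x - 8 * U x ^ 3 + 6 * U x ^ 5)) ^ 2 ≤ Φ ^ 2 := by
    have h1 := eLpNorm_two_sq_eq hf
    rw [← hN, ← ENNReal.ofReal_toReal hNfin, ← ENNReal.ofReal_pow ENNReal.toReal_nonneg,
      ENNReal.ofReal_eq_ofReal_iff (by positivity) (integral_nonneg fun x => sq_nonneg _)] at h1
    rw [← h1]
    exact pow_le_pow_left₀ ENNReal.toReal_nonneg (le_add_of_nonneg_right (by positivity)) 2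
  obtain ⟨h1, h2⟩ := hest Φ hΦ0 hint
  have hw1 : HasWeakDeriv 1 (fun x => u x - kinkZeroOne (x + y₁) + kinkZeroOne (-(x + y₂)))
      (fun x => V x - √2 * kinkZeroOne (x + y₁) * (1 - kinkZeroOne (x + y₁) ^ 2)
        - √2 * kinkZeroOne (-(x + y₂)) * (1 - kinkZeroOne (-(x + y₂)) ^ 2)) := by
    refine ((hU.sub (hkP y₁ y₂)).congr fun x => by ring).hasWeakDeriv ?_
    filter_upwards [huU] with x hx'
    rw [hx']; ring
  -- The radius `4 * 10 ^ 6 * Φ` dominates the square root of `10 ^ 13 * Φ ^ 2`; with `24000 * Φ`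
  -- for the exponential the total stays below `10 ^ 7 * Φ`.
  have hH := hOneNorm_le (r := 4 * 10 ^ 6 * Φ) hw1 (hy.ae_eq (hge y₁ y₂).symm) hy' (by positivity)
    (by
      rw [integral_congr_ae (g := fun x => (U x - kinkZeroOne (x + y₁)
        + kinkZeroOne (-(x + y₂))) ^ 2) (by
          filter_upwards [hge y₁ y₂] with x hx'
          rw [hx'])]
      refine h1.trans ?_
      nlinarith [sq_nonneg Φ])
  refine (add_le_add hH (ENNReal.ofReal_le_ofReal h2)).trans ?_
  rw [← ENNReal.ofReal_add (by positivity) (by positivity), ← ENNReal.ofReal_toReal hNfin,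
    ← ENNReal.ofReal_mul (by norm_num), ← ENNReal.ofReal_coe_nnreal,
    ← ENNReal.ofReal_add (by positivity) (by positivity)]
  refine ENNReal.ofReal_le_ofReal ?_
  have : 10 ^ 7 * Φ = 10 ^ 7 * N.toReal + δ := by rw [hΦ]; ring
  linarith

end
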